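/- **Setting.** Let $\Omega$ be a compact metric space. A chart is a homeomorphism $h\colon U\to D\times C$ from an open set $U\subset\Omega$ (a *box*) onto the product of a nonempty connected open set $D\subset\mathbb R$ and a topological space $C$. The sets $h^{-1}(D\times\{c\})$ are the *slices* of the box and the sets $h^{-1}(\{t\}\times C)$ its *verticals*. A *flat lamination* (with one-dimensional leaves) on $\Omega$ is given by an atlas of charts whose domains cover $\Omega$ and whose transition maps are locally of the form $(t,c)\mapsto(t+a,\gamma(c))$ with $a\in\mathbb R$ constant and $\gamma$ continuous; the boxes, slices and verticals of the lamination are those of all charts compatible with the atlas. The *leaf* of a point is the smallest connected set that contains the point and every slice it intersects; it is a one-dimensional manifold with a flat Riemannian metric given by the coordinates $t$. An *$\mathbb R$-tilable lamination* is a flat lamination whose verticals are totally disconnected, such that every leaf is isometric to $\mathbb R$ and there is a Cantor set $\Xi\subset\Omega$ whose intersection with every leaf is nonempty and discrete in the manifold topology of the leaf. It is *minimal* if every leaf is dense in $\Omega$. The group $\mathrm{Homeo}(\Omega)$ of homeomorphisms of $\Omega$ carries the metric $\delta(f,g)=\sup_x d(f(x),g(x))+\sup_x d(f^{-1}(x),g^{-1}(x))$.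 Let $\mathrm{Homeo}_{\mathcal L}(\Omega)$ be the subgroup of homeomorphisms mapping every leaf onto itself, and $\mathrm{Homeo}^0_{\mathcal L}(\Omega)$ the connected component of the identity in $\mathrm{Homeo}_{\mathcal L}(\Omega)$. Let $\mathrm{Homeo}_{vsp}(\Omega)$ be the subgroup of homeomorphisms $f$ of $\Omega$ that preserve the vertical structure: whenever $x$ lies in a vertical $V$ of a box and $f(x)$ lies in a vertical $V'$ of a box, there is a clopen subset $\tilde V$ of $V$ with $x\in\tilde V$ and $f(\tilde V)\subset V'$. Let $D_{vsp}(\Omega)$ be the path-connected component of the identity in $\mathrm{Homeo}_{vsp}(\Omega)$. **Theorem.** Let $\Omega$ be a minimal $\mathbb R$-tilable lamination. Then every element of $\mathrm{Homeo}^0_{\mathcal L}(\Omega)$ is a product of two commutators of elements of $\mathrm{Homeo}^0_{\mathcal L}(\Omega)$, and every element of $D_{vsp}(\Omega)$ is a product of two commutators of elements of $D_{vsp}(\Omega)$. In particular, both groups are uniformly perfect: there is an $N$ such that every element is a product of at most $N$ commutators. -/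

import Mathlib

open Set Filter Topology
open scoped commutatorElement

universe u

/-! ### The `C⁰`-metric on the homeomorphism group of a compact metric space -/

section HomeoMetric

variable {Ω : Type u} [MetricSpace Ω] [CompactSpace Ω]

/-- `δ(f, g) = sup_x d(f x, g x) + sup_x d(f⁻¹ x, g⁻¹ x)`. The suprema are over bounded families,
as `Ω` is compact. -/
noncomputable def homeoDist (f g : Ω ≃ₜ Ω) : ℝ :=
  (⨆ x, dist (f x) (g x)) + ⨆ x, dist (f⁻¹ x) (g⁻¹ x)

/-- A homeomorphism together with its inverse, as continuous maps. -/
def homeoPair (f : Ω ≃ₜ Ω) : C(Ω, Ω) × C(Ω, Ω) := ((f : C(Ω, Ω)), ((f⁻¹ : Ω ≃ₜ Ω) : C(Ω, Ω)))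

theorem homeoDist_eq (f g : Ω ≃ₜ Ω) :
    homeoDist f g = dist (homeoPair f).1 (homeoPair g).1 + dist (homeoPair f).2 (homeoPair g).2 := by
  rw [ContinuousMap.dist_eq_iSup, ContinuousMap.dist_eq_iSup]; rfl

noncomputable instance homeoMetricSpace : MetricSpace (Ω ≃ₜ Ω) where
  dist := homeoDist
  dist_self f := by simp [homeoDist]
  dist_comm f g := by simp only [homeoDist, dist_comm]
  dist_triangle f g h := by
    simp only [homeoDist_eq]
    linarith [dist_triangle (homeoPair f).1 (homeoPair g).1 (homeoPair h).1,
      dist_triangle (homeoPair f).2 (homeoPair g).2 (homeoPair h).2]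
  eq_of_dist_eq_zero {f g} h := by
    rw [homeoDist_eq] at h
    have h1 : dist (homeoPair f).1 (homeoPair g).1 = 0 :=
      le_antisymm (by linarith [dist_nonneg (x := (homeoPair f).2) (y := (homeoPair g).2)])
        dist_nonneg
    ext x
    exact DFunLike.congr_fun (dist_eq_zero.1 h1) x

theorem isInducing_homeoPair : IsInducing (homeoPair : (Ω ≃ₜ Ω) → C(Ω, Ω) × C(Ω, Ω)) := by
  have h1 : LipschitzWith 1 (homeoPair : (Ω ≃ₜ Ω) → C(Ω, Ω) × C(Ω, Ω)) := by
    refine LipschitzWith.of_dist_le_mul fun f g => ?_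
    change _ ≤ _ * homeoDist f g
    rw [homeoDist_eq, Prod.dist_eq]
    simp
  have h2 : AntilipschitzWith 2 (homeoPair : (Ω ≃ₜ Ω) → C(Ω, Ω) × C(Ω, Ω)) := by
    refine AntilipschitzWith.of_le_mul_dist fun f g => ?_
    change homeoDist f g ≤ _
    rw [homeoDist_eq, Prod.dist_eq]
    have a := le_max_left (dist (homeoPair f).1 (homeoPair g).1)
      (dist (homeoPair f).2 (homeoPair g).2)
    have b := le_max_right (dist (homeoPair f).1 (homeoPair g).1)
      (dist (homeoPair f).2 (homeoPair g).2)
    push_cast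
    linarith
  exact (h2.isUniformInducing h1.uniformContinuous).isInducing

instance homeoIsTopologicalGroup : IsTopologicalGroup (Ω ≃ₜ Ω) where
  continuous_mul := by
    have hc := (isInducing_homeoPair (Ω := Ω)).continuous
    refine isInducing_homeoPair.continuous_iff.2 (Continuous.prodMk ?_ ?_)
    · exact Continuous.compCM (continuous_fst.comp (hc.comp continuous_fst))
        (continuous_fst.comp (hc.comp continuous_snd))
    · exact Continuous.compCM (continuous_snd.comp (hc.comp continuous_snd))
        (continuous_snd.comp (hc.comp continuous_fst))
  continuous_inv := by
    have hc := (isInducing_homeoPair (Ω := Ω)).continuous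
    exact isInducing_homeoPair.continuous_iff.2
      ((continuous_snd.comp hc).prodMk (continuous_fst.comp hc))

end HomeoMetric

/-! ### Topological groups and uniform perfectness -/

/-- The path-connected component of the identity in a topological group. -/
def Subgroup.pathComponentOfOne (G : Type*) [Group G] [TopologicalSpace G]
    [IsTopologicalGroup G] : Subgroup G where
  carrier := pathComponent (1 : G)
  one_mem' := mem_pathComponent_self 1
  mul_mem' {a b} ha hb := by
    have h : Joined (1 * 1 : G) (a * b) := Joined.mul ha hb
    rwa [one_mul] at h
  inv_mem' {a} ha := by
    have h : Joined (1⁻¹ : G) a⁻¹ := Joined.inv ha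
    rwa [inv_one] at h

/-- A group is uniformly perfect if, for some `N`, every element is a product of at most `N`
commutators. -/
def IsUniformlyPerfect (G : Type*) [Group G] : Prop :=
  ∃ N : ℕ, ∀ g : G, ∃ l : List G, l.length ≤ N ∧ (∀ c ∈ l, c ∈ commutatorSet G) ∧ l.prod = g

/-! ### Flat laminations with one-dimensional leaves -/

/-- A chart of a one-dimensional flat lamination: a homeomorphism from the open set `source` (the
box) onto `D × C`, where `D` is a nonempty connected open subset of `ℝ` and `C` is a topological
space. -/
structure FlatChart (Ω : Type u) [TopologicalSpace Ω] where
  C : Type u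
  [topC : TopologicalSpace C]
  toHomeo : OpenPartialHomeomorph Ω (ℝ × C)
  D : Set ℝ
  isOpen_D : IsOpen D
  isConnected_D : IsConnected D
  target_eq : toHomeo.target = D ×ˢ (univ : Set C)

namespace FlatChart

variable {Ω : Type u} [TopologicalSpace Ω]

attribute [instance] FlatChart.topC

/-- The box of the chart. -/
def source (h : FlatChart Ω) : Set Ω := h.toHomeo.source

/-- The leafwise coordinate. -/
def tcoord (h : FlatChart Ω) (x : Ω) : ℝ := (h.toHomeo x).1

/-- The transverse coordinate. -/
def ccoord (h : FlatChart Ω) (x : Ω) : h.C := (h.toHomeo x).2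

/-- The slice `h⁻¹(D × {c})` of the box through `x`. -/
def slice (h : FlatChart Ω) (x : Ω) : Set Ω := {y | y ∈ h.source ∧ h.ccoord y = h.ccoord x}

/-- The vertical `h⁻¹({t} × C)` of the box through `x`. -/
def vertical (h : FlatChart Ω) (x : Ω) : Set Ω := {y | y ∈ h.source ∧ h.tcoord y = h.tcoord x}

/-- The transition map from `h` to `k` is locally of the form `(t, c) ↦ (t + a, γ c)` with `a`
constant and `γ` continuous. -/
def Compat (h k : FlatChart Ω) : Prop :=
  ∀ x, x ∈ h.source → x ∈ k.source → ∃ V : Set Ω, IsOpen V ∧ x ∈ V ∧ V ⊆ h.source ∩ k.source ∧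
    ∃ (a : ℝ) (γ : h.C → k.C), ContinuousOn γ (h.ccoord '' V) ∧
      ∀ y ∈ V, k.tcoord y = h.tcoord y + a ∧ k.ccoord y = γ (h.ccoord y)

theorem mem_vertical_self {h : FlatChart Ω} {x : Ω} (hx : x ∈ h.source) : x ∈ h.vertical x :=
  ⟨hx, rfl⟩

end FlatChart

/-- A flat lamination with one-dimensional leaves, given by an atlas. -/
structure FlatLamination (Ω : Type u) [TopologicalSpace Ω] where
  atlas : Set (FlatChart Ω)
  cover : ∀ x, ∃ h ∈ atlas, x ∈ h.source
  compat : ∀ h ∈ atlas, ∀ k ∈ atlas, h.Compat k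

namespace FlatLamination

variable {Ω : Type u} [TopologicalSpace Ω]

/-- The maximal atlas. Its charts are the charts of the lamination; their domains are the boxes. -/
def maximalAtlas (L : FlatLamination Ω) : Set (FlatChart Ω) :=
  {h | ∀ k ∈ L.atlas, h.Compat k ∧ k.Compat h}

/-- A set is slice-saturated if it contains every slice of a box that it intersects. -/
def IsSaturated (L : FlatLamination Ω) (S : Set Ω) : Prop :=
  ∀ h ∈ L.maximalAtlas, ∀ x ∈ h.source, (h.slice x ∩ S).Nonempty → h.slice x ⊆ S

/-- The leaf of `x`: the smallest connected set that contains `x` and all the slices that it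
intersects. -/
def leaf (L : FlatLamination Ω) (x : Ω) : Set Ω :=
  ⋂₀ {S | x ∈ S ∧ IsConnected S ∧ L.IsSaturated S}

/-- `φ` is an isometry of `ℝ` onto the leaf of `x`, where the leaf carries the flat Riemannian
metric (and the manifold topology) read off from the leafwise coordinates of the charts: it is a
bijection onto the leaf which, near each parameter, takes values in a single slice and is isometric
for the leafwise coordinate. -/
structure IsLeafIsometry (L : FlatLamination Ω) (x : Ω) (φ : ℝ → Ω) : Prop where
  injective : Function.Injective φ
  range_eq : range φ = L.leaf x
  isometric : ∀ h ∈ L.maximalAtlas, ∀ s : ℝ, φ s ∈ h.source →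
    ∃ ε > 0, ∀ s₁ ∈ Metric.ball s ε, ∀ s₂ ∈ Metric.ball s ε,
      φ s₁ ∈ h.slice (φ s) ∧ φ s₂ ∈ h.slice (φ s) ∧
        dist (h.tcoord (φ s₁)) (h.tcoord (φ s₂)) = dist s₁ s₂

/-- A transversal: a compact set whose intersection with each leaf is nonempty, and discrete for the
manifold topology of the leaf. -/
def IsTransversal (L : FlatLamination Ω) (Ξ : Set Ω) : Prop :=
  IsCompact Ξ ∧ ∀ x, (L.leaf x ∩ Ξ).Nonempty ∧
    ∀ φ, L.IsLeafIsometry x φ → DiscreteTopology (φ ⁻¹' Ξ)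

end FlatLamination

/-- An `ℝ`-tilable lamination. -/
structure TilableLamination (Ω : Type u) [TopologicalSpace Ω] extends FlatLamination Ω where
  /-- The verticals are totally disconnected. -/
  totallyDisconnected : ∀ h ∈ toFlatLamination.maximalAtlas, TotallyDisconnectedSpace h.C
  /-- Every leaf is isometric to `ℝ`. -/
  leaf_isometric : ∀ x, ∃ φ, toFlatLamination.IsLeafIsometry x φ
  /-- There is a transversal which is a Cantor set. -/
  exists_cantor_transversal : ∃ Ξ : Set Ω, toFlatLamination.IsTransversal Ξ ∧
    Nonempty (Ξ ≃ₜ (ℕ → Bool))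

namespace TilableLamination

/-- Every leaf is dense. -/
def IsMinimal {Ω : Type u} [TopologicalSpace Ω] (L : TilableLamination Ω) : Prop :=
  ∀ x, Dense (L.leaf x)

/-- The homeomorphism `f` preserves the vertical structure: given a point `x` in a vertical `C` of a
box `h` and a vertical `C'` of a box `k` containing `f x`, there is a clopen subset `K` of `C`
containing `x` that `f` maps into `C'`. -/
def PreservesVertical {Ω : Type u} [TopologicalSpace Ω] (L : TilableLamination Ω) (f : Ω ≃ₜ Ω) :
    Prop :=
  ∀ h ∈ L.maximalAtlas, ∀ k ∈ L.maximalAtlas, ∀ (x : Ω) (hx : x ∈ h.source), f x ∈ k.source →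
    ∃ K : Set (h.vertical x), IsClopen K ∧ ⟨x, FlatChart.mem_vertical_self hx⟩ ∈ K ∧
      ∀ y ∈ K, f y ∈ k.vertical (f x)

theorem mem_maximalAtlas {Ω : Type u} [TopologicalSpace Ω] (L : TilableLamination Ω) {h : FlatChart Ω} (hh : h ∈ L.atlas) :
    h ∈ L.maximalAtlas :=
  fun k hk => ⟨L.compat h hh k hk, L.compat k hk h hh⟩

section Lemmas

variable {Ω : Type u} [TopologicalSpace Ω] [CompactSpace Ω] [T2Space Ω]

theorem exists_clopen_in_vertical (L : TilableLamination Ω) {h : FlatChart Ω}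
    (hh : h ∈ L.maximalAtlas) (x : Ω) (p : h.vertical x) (U : Set (h.vertical x))
    (hU : U ∈ 𝓝 p) : ∃ K : Set (h.vertical x), IsClopen K ∧ p ∈ K ∧ K ⊆ U := by
  have := L.totallyDisconnected h hh
  have hcont : ContinuousOn h.toHomeo h.source := h.toHomeo.continuousOn
  have hlc : IsLocallyClosed (h.vertical x) := by
    have hc : ContinuousOn (fun y => (h.toHomeo y).1) h.source :=
      continuous_fst.comp_continuousOn hcont
    obtain ⟨F, hF, hF'⟩ := (continuousOn_iff_isClosed.1 hc) {h.tcoord x} isClosed_singleton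
    refine ⟨h.source, F, h.toHomeo.open_source, hF, ?_⟩
    rw [inter_comm, ← hF', inter_comm]
    rfl
  have : LocallyCompactSpace (h.vertical x) := hlc.locallyCompactSpace
  have : TotallyDisconnectedSpace (h.vertical x) := by
    refine ⟨fun S _ hS a ha b hb => ?_⟩
    have hc : Continuous (fun y : h.vertical x => (h.toHomeo y).2) :=
      continuous_snd.comp (hcont.comp_continuous continuous_subtype_val fun y => y.2.1)
    have h2 : (h.toHomeo a).2 = (h.toHomeo b).2 :=
      (hS.image _ hc.continuousOn).subsingleton (mem_image_of_mem _ ha) (mem_image_of_mem _ hb)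
    have h1 : (h.toHomeo a).1 = (h.toHomeo b).1 := a.2.2.trans b.2.2.symm
    exact Subtype.ext (h.toHomeo.injOn a.2.1 b.2.1 (Prod.ext h1 h2))
  obtain ⟨K, hK, hp, hKU⟩ := loc_compact_Haus_tot_disc_of_zero_dim.mem_nhds_iff.1 hU
  exact ⟨K, hK, hp, hKU⟩

theorem preservesVertical_iff (L : TilableLamination Ω) (f : Ω ≃ₜ Ω) :
    L.PreservesVertical f ↔ ∀ h ∈ L.maximalAtlas, ∀ k ∈ L.maximalAtlas, ∀ x ∈ h.source,
      f x ∈ k.source → ∀ᶠ y in 𝓝[h.vertical x] x, f y ∈ k.vertical (f x) := by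
  refine forall₂_congr fun h hh => forall₂_congr fun k _ => forall₂_congr fun x hx =>
    forall_congr' fun _ => ?_
  rw [nhdsWithin_eq_map_subtype_coe (FlatChart.mem_vertical_self hx), eventually_map]
  constructor
  · rintro ⟨K, hK, hxK, H⟩
    exact mem_of_superset (hK.isOpen.mem_nhds hxK) fun y hy => H y hy
  · intro H
    obtain ⟨K, hK, hp, hKU⟩ := L.exists_clopen_in_vertical hh x _ _ H
    exact ⟨K, hK, hp, fun y hy => hKU hy⟩

theorem PreservesVertical.one (L : TilableLamination Ω) : L.PreservesVertical 1 := by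
  rw [preservesVertical_iff]
  intro h hh k hk x hx hx'
  obtain ⟨m, hm, hxm⟩ := L.cover x
  obtain ⟨V, hV, hxV, -, a, _, -, H⟩ := (hh m hm).1 x hx hxm
  obtain ⟨V', hV', hxV', hs, a', _, -, H'⟩ := (hk m hm).2 x hxm hx'
  filter_upwards [mem_nhdsWithin_of_mem_nhds (hV.mem_nhds hxV),
    mem_nhdsWithin_of_mem_nhds (hV'.mem_nhds hxV'), self_mem_nhdsWithin] with y hy hy' hyv
  refine ⟨(hs hy').2, ?_⟩
  change k.tcoord y = k.tcoord x
  rw [(H' y hy').1, (H' x hxV').1, (H y hy).1, (H x hxV).1, hyv.2]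

theorem PreservesVertical.mul {L : TilableLamination Ω} {f g : Ω ≃ₜ Ω}
    (hf : L.PreservesVertical f) (hg : L.PreservesVertical g) : L.PreservesVertical (f * g) := by
  rw [preservesVertical_iff] at hf hg ⊢
  intro h hh k hk x hx hx'
  obtain ⟨m, hm, hxm⟩ := L.cover (g x)
  have hm' := L.mem_maximalAtlas hm
  have h1 := hg h hh m hm' x hx hxm
  have h2 := hf m hm' k hk (g x) hxm hx'
  have ht : Tendsto g (𝓝[h.vertical x] x) (𝓝[m.vertical (g x)] (g x)) :=
    tendsto_nhdsWithin_iff.2 ⟨g.continuous.continuousAt.tendsto.mono_left nhdsWithin_le_nhds, h1⟩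
  exact ht.eventually h2

theorem PreservesVertical.inv {L : TilableLamination Ω} {f : Ω ≃ₜ Ω}
    (hf : L.PreservesVertical f) : L.PreservesVertical f⁻¹ := by
  rw [preservesVertical_iff] at hf ⊢
  intro h hh k hk x hx hx'
  have := L.totallyDisconnected h hh
  obtain ⟨y, rfl⟩ := f.surjective x
  have hfy : f⁻¹ (f y) = y := f.symm_apply_apply y
  rw [hfy] at hx' ⊢
  have H := hf k hk h hh y hx' hx
  obtain ⟨O, hO, hyO, HO⟩ := mem_nhdsWithin.1 H
  have hU : k.toHomeo.symm ⁻¹' (O ∩ f ⁻¹' h.source) ∈ 𝓝 (k.toHomeo y) := by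
    refine (k.toHomeo.continuousAt_symm (k.toHomeo.map_source hx')).preimage_mem_nhds ?_
    rw [k.toHomeo.left_inv hx']
    exact inter_mem (hO.mem_nhds hyO)
      ((h.toHomeo.open_source.preimage f.continuous).mem_nhds hx)
  have hT : k.toHomeo.target ∈ 𝓝 (k.toHomeo y) :=
    k.toHomeo.open_target.mem_nhds (k.toHomeo.map_source hx')
  obtain ⟨J, hJ, W, hW, hJW⟩ := mem_nhds_prod_iff.1 (inter_mem hU hT)
  obtain ⟨ε, hε, hεJ⟩ := Metric.mem_nhds_iff.1 hJ
  have key : ∀ c ∈ W, ∀ s₁ ∈ Metric.ball (k.toHomeo y).1 ε, ∀ s₂ ∈ Metric.ball (k.toHomeo y).1 ε,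
      (h.toHomeo (f (k.toHomeo.symm (s₁, c)))).2 = (h.toHomeo (f (k.toHomeo.symm (s₂, c)))).2 := by
    intro c hc s₁ h₁ s₂ h₂
    have hin : ∀ s ∈ Metric.ball (k.toHomeo y).1 ε, (s, c) ∈
        k.toHomeo.symm ⁻¹' (O ∩ f ⁻¹' h.source) ∩ k.toHomeo.target :=
      fun s hs => hJW ⟨hεJ hs, hc⟩
    have hcont : ContinuousOn (fun s : ℝ => (h.toHomeo (f (k.toHomeo.symm (s, c)))).2)
        (Metric.ball (k.toHomeo y).1 ε) := by
      refine continuous_snd.comp_continuousOn (h.toHomeo.continuousOn.comp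
        (f.continuous.comp_continuousOn (k.toHomeo.continuousOn_symm.comp
          (by fun_prop) fun s hs => (hin s hs).2)) fun s hs => (hin s hs).1.2)
    exact ((convex_ball _ _).isPreconnected.image _ hcont).subsingleton
      (mem_image_of_mem _ h₁) (mem_image_of_mem _ h₂)
  have hN : k.source ∩ k.toHomeo ⁻¹' (Metric.ball (k.toHomeo y).1 ε ×ˢ W) ∈ 𝓝 y :=
    inter_mem (k.toHomeo.open_source.mem_nhds hx')
      ((k.toHomeo.continuousAt hx').preimage_mem_nhds
        (prod_mem_nhds (Metric.ball_mem_nhds _ hε) hW))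
  have hN' : ∀ᶠ z in 𝓝[h.vertical (f y)] (f y),
      f⁻¹ z ∈ k.source ∩ k.toHomeo ⁻¹' (Metric.ball (k.toHomeo y).1 ε ×ˢ W) := by
    refine mem_nhdsWithin_of_mem_nhds (f.symm.continuous.continuousAt.preimage_mem_nhds ?_)
    rwa [f.symm_apply_apply]
  filter_upwards [hN', self_mem_nhdsWithin] with z hz hzv
  obtain ⟨hzk, hzt, hzc⟩ := hz
  set w := f⁻¹ z with hw
  have hfw : f w = z := f.apply_symm_apply z
  have hyb : (k.toHomeo y).1 ∈ Metric.ball (k.toHomeo y).1 ε := Metric.mem_ball_self hε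
  set w' := k.toHomeo.symm ((k.toHomeo y).1, (k.toHomeo w).2) with hw'
  have hin := hJW (show ((k.toHomeo y).1, (k.toHomeo w).2) ∈ J ×ˢ W from ⟨hεJ hyb, hzc⟩)
  have hw'v : w' ∈ k.vertical y := by
    refine ⟨k.toHomeo.map_target hin.2, ?_⟩
    change (k.toHomeo w').1 = _
    rw [hw', k.toHomeo.right_inv hin.2]
    rfl
  have hfw' : f w' ∈ h.vertical (f y) := HO ⟨hin.1.1, hw'v⟩
  have e1 : (h.toHomeo (f w')).1 = (h.toHomeo z).1 := hfw'.2.trans hzv.2.symm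
  have e2 : (h.toHomeo (f w')).2 = (h.toHomeo z).2 := by
    have := key _ hzc _ hyb _ hzt
    rw [show ((k.toHomeo w).1, (k.toHomeo w).2) = k.toHomeo w from rfl,
      k.toHomeo.left_inv hzk, hfw] at this
    exact this
  have e3 : f w' = z := h.toHomeo.injOn hfw'.1 hzv.1 (Prod.ext e1 e2)
  have e4 : w' = w := f.injective (e3.trans hfw.symm)
  exact e4 ▸ hw'v

end Lemmas

/-! ### The groups of homeomorphisms -/

variable {Ω : Type u} [MetricSpace Ω] [CompactSpace Ω]

/-- The group of leaf-preserving homeomorphisms: those mapping each leaf onto itself. -/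
def homeoL (L : TilableLamination Ω) : Subgroup (Ω ≃ₜ Ω) where
  carrier := {f | ∀ x, f '' L.leaf x = L.leaf x}
  one_mem' x := image_id _
  mul_mem' {f g} hf hg x := by
    change (fun y => f (g y)) '' L.leaf x = L.leaf x
    rw [← image_image, hg x, hf x]
  inv_mem' {f} hf x := by
    have h : f.symm '' (f '' L.leaf x) = L.leaf x := by simp [image_image]
    rw [hf x] at h
    exact h

/-- The group of homeomorphisms preserving the vertical structure. -/
def homeoVsp (L : TilableLamination Ω) : Subgroup (Ω ≃ₜ Ω) where
  carrier := {f | L.PreservesVertical f}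
  one_mem' := PreservesVertical.one L
  mul_mem' hf hg := PreservesVertical.mul hf hg
  inv_mem' hf := PreservesVertical.inv hf

/-- The connected component of the identity in the group of leaf-preserving homeomorphisms, for the
`C⁰`-topology. -/
noncomputable def homeoLZero (L : TilableLamination Ω) : Subgroup L.homeoL :=
  Subgroup.connectedComponentOfOne L.homeoL

/-- The path-connected component of the identity in the group of homeomorphisms preserving the
vertical structure, for the `C⁰`-topology. -/
noncomputable def dVsp (L : TilableLamination Ω) : Subgroup L.homeoVsp :=
  Subgroup.pathComponentOfOne L.homeoVsp

end TilableLamination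

/-! Transition maps shift the leafwise coordinate, so the leaves carry a coherent orientation, and
unit-speed translation along them is a flow `T` on `Ω`. It is free because leaves are lines, its
orbits are dense by minimality, and connected subsets of a box lie in slices. The proof uses only
these features, recorded in `IsTransverseTo`.

A leaf-preserving homeomorphism is `f x = T (α x) x`. Its displacement `α` is continuous
(`continuous_displacement`, by Baire), and `s ↦ s + α (T s x)` is increasing. Multiplying `α` by `t
∈ [0, 1]` gives an isotopy to the identity, so `Homeo_L` is path-connected. Moreover `f` preserves
the verticals iff `α` is locally constant along them, a property kept by the isotopy; conversely a
path from the identity moves each point inside its leaf. So `D_vsp` consists of the leaf-preserving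
elements of `Homeo_vsp` (`mem_dVsp_iff`), and both claims reduce to `exists_two_commutators`.

Fragmentation (`exists_fragment`): clamping `α` by a bump function around a cross-section with long
return times gives `f₁` equal to `f` near one cross-section and to the identity near another. In `f
= f₁ * (f₁⁻¹ * f)` each factor is the identity near a cross-section `C`.

Such a factor is a commutator (`IsCrossSection.exists_commutator`). Cutting along `C` presents `Ω`
as a suspension of `C × [0, 1]` and the factor as a family `H c` supported in `[δ, 1 - δ]`. Identify
`(0, 1)` with `ℝ` so that the supports lie in `[0, 1]`, let `G c` repeat `H c` on every `[n, n +
1]`, `n ≥ 0`, and let `τ` be translation by `1`. Then `τ * G c * τ⁻¹` lacks just the first copy, so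
`H c = ⁅G c, τ⁆`. Since `τ` does not depend on `c`, and `G c u` is a function of one value of `H c`,
continuity and transverse local constancy are inherited. -/

/-! ### Order automorphisms of the line -/

section OrderAutomorphisms

/-- Order automorphisms of `ℝ` which depend continuously on a parameter at each point are jointly
continuous. -/
theorem continuous_uncurry_orderIso {X : Type*} [TopologicalSpace X] {G : X → ℝ ≃o ℝ}
    (hG : ∀ u, Continuous fun c => G c u) : Continuous fun p : X × ℝ => G p.1 p.2 := by
  rw [continuous_iff_continuousAt]
  rintro ⟨c, u⟩
  -- By monotonicity one intermediate point `v` is enough: a bound at `v`, stable under small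
  -- changes of `c`, holds on a whole ray, which is a neighbourhood of `u`.
  refine tendsto_order.2 ⟨fun a ha => ?_, fun a ha => ?_⟩
  · have h1 : (G c).symm a < u := by rwa [← (G c).lt_iff_lt, OrderIso.apply_symm_apply]
    obtain ⟨v, hv, hvu⟩ := exists_between h1
    have h2 : a < G c v := by rwa [← OrderIso.apply_symm_apply (G c) a, (G c).lt_iff_lt]
    have e1 : ∀ᶠ p : X × ℝ in 𝓝 (c, u), a < G p.1 v :=
      ((hG v).comp continuous_fst).continuousAt.eventually (lt_mem_nhds h2)
    have e2 : ∀ᶠ p : X × ℝ in 𝓝 (c, u), v < p.2 :=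
      continuous_snd.continuousAt.eventually (lt_mem_nhds hvu)
    filter_upwards [e1, e2] with p hp hp'
    exact hp.trans ((G p.1).strictMono hp')
  · have h1 : u < (G c).symm a := by rwa [← (G c).lt_iff_lt, OrderIso.apply_symm_apply]
    obtain ⟨v, hv, hvu⟩ := exists_between h1
    have h2 : G c v < a := by rwa [← OrderIso.apply_symm_apply (G c) a, (G c).lt_iff_lt]
    have e1 : ∀ᶠ p : X × ℝ in 𝓝 (c, u), G p.1 v < a :=
      ((hG v).comp continuous_fst).continuousAt.eventually (gt_mem_nhds h2)
    have e2 : ∀ᶠ p : X × ℝ in 𝓝 (c, u), p.2 < v :=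
      continuous_snd.continuousAt.eventually (gt_mem_nhds hv)
    filter_upwards [e1, e2] with p hp hp'
    exact ((G p.1).strictMono hp').trans hp

/-- The translation by `1`. -/
def translateOne : ℝ ≃o ℝ := OrderIso.addRight 1

@[simp] theorem translateOne_apply (x : ℝ) : translateOne x = x + 1 := rfl

/-- The function that repeats `K` on each of the intervals `[n, n + 1]`, `n ≥ 0`. -/
noncomputable def repeatFun (K : ℝ → ℝ) (x : ℝ) : ℝ := if x < 0 then x else ⌊x⌋ + K (Int.fract x)

theorem repeatFun_of_floor {K : ℝ → ℝ} {x y : ℝ} {n : ℤ} (hn : 0 ≤ n) (hy : 0 ≤ y) (hy1 : y < 1)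
    (hx : x = n + y) : repeatFun K x = n + K y := by
  have h1 : ⌊x⌋ = n := by
    rw [Int.floor_eq_iff, hx]; constructor <;> linarith
  have h2 : Int.fract x = y := by rw [Int.fract, h1, hx]; ring
  have h3 : ¬ x < 0 := by
    have : (0 : ℝ) ≤ n := by exact_mod_cast hn
    linarith
  rw [repeatFun, if_neg h3, h1, h2]

theorem exists_floor_decomp {x : ℝ} (hx : 0 ≤ x) :
    ∃ (n : ℤ) (y : ℝ), 0 ≤ n ∧ 0 ≤ y ∧ y < 1 ∧ x = n + y :=
  ⟨⌊x⌋, Int.fract x, Int.floor_nonneg.2 hx, Int.fract_nonneg x, Int.fract_lt_one x,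
    (Int.floor_add_fract x).symm⟩

theorem orderIso_mem_Ico {K : ℝ ≃o ℝ} (h0 : K 0 = 0) (h1 : K 1 = 1) {y : ℝ} (hy : 0 ≤ y)
    (hy1 : y < 1) : 0 ≤ K y ∧ K y < 1 := by
  constructor
  · rw [← h0]; exact K.monotone hy
  · rw [← h1]; exact K.strictMono hy1

theorem repeatFun_strictMono {K : ℝ ≃o ℝ} (h0 : K 0 = 0) (h1 : K 1 = 1) :
    StrictMono (repeatFun K) := by
  intro x y hxy
  rcases lt_or_ge x 0 with hx | hx
  · rcases lt_or_ge y 0 with hy | hy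
    · simpa [repeatFun, hx, hy] using hxy
    · obtain ⟨n, w, hn, hw, hw1, e⟩ := exists_floor_decomp hy
      rw [repeatFun_of_floor hn hw hw1 e, repeatFun, if_pos hx]
      have := (orderIso_mem_Ico h0 h1 hw hw1).1
      have hn' : (0 : ℝ) ≤ n := by exact_mod_cast hn
      linarith
  · obtain ⟨m, v, hm, hv, hv1, e'⟩ := exists_floor_decomp hx
    obtain ⟨n, w, hn, hw, hw1, e⟩ := exists_floor_decomp (hx.trans hxy.le)
    rw [repeatFun_of_floor hn hw hw1 e, repeatFun_of_floor hm hv hv1 e']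
    have a := orderIso_mem_Ico h0 h1 hw hw1
    have b := orderIso_mem_Ico h0 h1 hv hv1
    rcases lt_trichotomy m n with hmn | hmn | hmn
    · have : (m : ℝ) + 1 ≤ n := by exact_mod_cast hmn
      linarith
    · subst hmn
      have : v < w := by linarith
      have := K.strictMono this
      linarith
    · have : (n : ℝ) + 1 ≤ m := by exact_mod_cast hmn
      linarith

theorem repeatFun_surjective {K : ℝ ≃o ℝ} (h0 : K 0 = 0) (h1 : K 1 = 1) :
    Function.Surjective (repeatFun K) := by
  intro x
  rcases lt_or_ge x 0 with hx | hx
  · exact ⟨x, by simp [repeatFun, hx]⟩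
  · obtain ⟨m, v, hm, hv, hv1, e⟩ := exists_floor_decomp hx
    have h0' : K.symm 0 = 0 := by rw [OrderIso.symm_apply_eq, h0]
    have h1' : K.symm 1 = 1 := by rw [OrderIso.symm_apply_eq, h1]
    have a := orderIso_mem_Ico h0' h1' hv hv1
    refine ⟨m + K.symm v, ?_⟩
    rw [repeatFun_of_floor hm a.1 a.2 rfl, OrderIso.apply_symm_apply, e]

/-- An order automorphism supported in `[0, 1]` is a commutator. -/
theorem exists_repeat_commutator {K : ℝ ≃o ℝ} (h0 : K 0 = 0) (h1 : K 1 = 1)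
    (hK : ∀ x, x ≤ 0 ∨ 1 ≤ x → K x = x) :
    ∃ G : ℝ ≃o ℝ, (∀ x, G x = repeatFun K x) ∧ K = ⁅G, translateOne⁆ := by
  refine ⟨StrictMono.orderIsoOfSurjective _ (repeatFun_strictMono h0 h1)
    (repeatFun_surjective h0 h1), fun x => rfl, ?_⟩
  set G := StrictMono.orderIsoOfSurjective _ (repeatFun_strictMono h0 h1)
    (repeatFun_surjective h0 h1)
  have hG : ∀ x, G x = repeatFun K x := fun x => rfl
  -- The identity becomes `K (G x + 1) = G (x + 1)`. For `x ≥ 0` the outer `K` acts beyond its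
  -- support and both sides shift by a period; for `-1 ≤ x < 0` both sides are the first copy of
  -- `K`.
  rw [commutatorElement_def, eq_mul_inv_iff_mul_eq, eq_mul_inv_iff_mul_eq]
  ext x
  simp only [RelIso.coe_mul, Function.comp_apply, translateOne_apply, hG]
  rcases lt_or_ge x 0 with hx | hx
  · rw [show repeatFun K x = x by simp [repeatFun, hx]]
    rcases lt_or_ge (x + 1) 0 with hx' | hx'
    · rw [hK _ (Or.inl hx'.le)]; simp [repeatFun, hx']
    · rw [repeatFun_of_floor (n := 0) (y := x + 1) le_rfl hx' (by linarith) (by simp)]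
      simp
  · obtain ⟨m, v, hm, hv, hv1, e⟩ := exists_floor_decomp hx
    have hm' : (0 : ℝ) ≤ m := by exact_mod_cast hm
    have a := orderIso_mem_Ico h0 h1 hv hv1
    rw [repeatFun_of_floor hm hv hv1 e, hK _ (Or.inr (by linarith)),
      repeatFun_of_floor (n := m + 1) (y := v) (by omega) hv hv1 (by push_cast; linarith)]
    push_cast
    ring

/-- An increasing parametrization of `(0, 1)` by `ℝ`. -/
noncomputable def lineIsoIoo (N : ℝ) (hN : 0 < N) : ℝ ≃o Ioo (0 : ℝ) 1 :=
  StrictMono.orderIsoOfSurjective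
    (fun x => ⟨Real.sigmoid (N * (2 * x - 1)), Real.sigmoid_pos _, Real.sigmoid_lt_one _⟩)
    (fun x y hxy => Subtype.mk_lt_mk.2 (Real.sigmoid_strictMono (by nlinarith)))
    (fun u => by
      have hu : (u : ℝ) ∈ range Real.sigmoid := by rw [Real.range_sigmoid]; exact u.2
      obtain ⟨y, hy⟩ := hu
      refine ⟨(y / N + 1) / 2, Subtype.ext ?_⟩
      simp only
      rw [show N * (2 * ((y / N + 1) / 2) - 1) = y by field_simp; ring, hy])

/-- A large steepness `N` makes the image of `[0, 1]` cover `[δ, 1 - δ]`. A map supported there is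
then supported in `[0, 1]` on the line, which leaves room for infinitely many copies. -/
theorem exists_lineIsoIoo {δ : ℝ} (hδ : 0 < δ) : ∃ e : ℝ ≃o Ioo (0 : ℝ) 1,
    (e 0 : ℝ) ≤ δ ∧ 1 - δ ≤ (e 1 : ℝ) := by
  have h1 : ∀ᶠ N in atTop, Real.sigmoid (-N) < δ :=
    (Real.tendsto_sigmoid_atBot.comp tendsto_neg_atTop_atBot).eventually (gt_mem_nhds hδ)
  have h2 : ∀ᶠ N in atTop, 1 - δ < Real.sigmoid N :=
    Real.tendsto_sigmoid_atTop.eventually (lt_mem_nhds (by linarith))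
  obtain ⟨N, h1, h2, hN⟩ := (h1.and (h2.and (eventually_gt_atTop 0))).exists
  refine ⟨lineIsoIoo N hN, ?_, ?_⟩
  · change Real.sigmoid (N * (2 * 0 - 1)) ≤ δ
    rw [show N * (2 * 0 - 1) = -N by ring]; exact h1.le
  · change 1 - δ ≤ Real.sigmoid (N * (2 * 1 - 1))
    rw [show N * (2 * 1 - 1) = N by ring]; exact h2.le

/-- The extension by the identity of the conjugate of `K` to `(0, 1)`. -/
noncomputable def extendFun (e : ℝ ≃o Ioo (0 : ℝ) 1) (K : ℝ → ℝ) (u : ℝ) : ℝ :=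
  if h : u ∈ Ioo (0 : ℝ) 1 then e (K (e.symm ⟨u, h⟩)) else u

theorem extendFun_coe (e : ℝ ≃o Ioo (0 : ℝ) 1) (K : ℝ → ℝ) (x : ℝ) :
    extendFun e K (e x) = e (K x) := by
  rw [extendFun, dif_pos (e x).2]; simp

theorem extendFun_of_notMem (e : ℝ ≃o Ioo (0 : ℝ) 1) (K : ℝ → ℝ) {u : ℝ}
    (hu : u ∉ Ioo (0 : ℝ) 1) : extendFun e K u = u := by rw [extendFun, dif_neg hu]

theorem extendFun_comp (e : ℝ ≃o Ioo (0 : ℝ) 1) (K K' : ℝ → ℝ) (u : ℝ) :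
    extendFun e K (extendFun e K' u) = extendFun e (K ∘ K') u := by
  by_cases hu : u ∈ Ioo (0 : ℝ) 1
  · obtain ⟨x, hx⟩ := e.surjective ⟨u, hu⟩
    obtain rfl : (e x : ℝ) = u := by rw [hx]
    simp only [extendFun_coe, Function.comp]
  · simp only [extendFun_of_notMem _ _ hu]

theorem extendFun_id (e : ℝ ≃o Ioo (0 : ℝ) 1) (u : ℝ) : extendFun e id u = u := by
  by_cases hu : u ∈ Ioo (0 : ℝ) 1
  · obtain ⟨x, hx⟩ := e.surjective ⟨u, hu⟩
    obtain rfl : (e x : ℝ) = u := by rw [hx]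
    simp only [extendFun_coe, id]
  · simp only [extendFun_of_notMem _ _ hu]

theorem extendFun_monotone (e : ℝ ≃o Ioo (0 : ℝ) 1) (K : ℝ ≃o ℝ) : Monotone (extendFun e K) := by
  intro u v huv
  by_cases hu : u ∈ Ioo (0 : ℝ) 1
  · obtain ⟨x, hx⟩ := e.surjective ⟨u, hu⟩
    obtain rfl : (e x : ℝ) = u := by rw [hx]
    by_cases hv : v ∈ Ioo (0 : ℝ) 1
    · obtain ⟨y, hy⟩ := e.surjective ⟨v, hv⟩
      obtain rfl : (e y : ℝ) = v := by rw [hy]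
      rw [extendFun_coe, extendFun_coe]
      exact e.monotone (K.monotone (e.le_iff_le.1 huv))
    · rw [extendFun_coe, extendFun_of_notMem _ _ hv]
      have : 1 ≤ v := not_lt.1 fun h => hv ⟨hu.1.trans_le huv, h⟩
      exact (e (K x)).2.2.le.trans this
  · by_cases hv : v ∈ Ioo (0 : ℝ) 1
    · obtain ⟨y, hy⟩ := e.surjective ⟨v, hv⟩
      obtain rfl : (e y : ℝ) = v := by rw [hy]
      rw [extendFun_coe, extendFun_of_notMem _ _ hu]
      have : u ≤ 0 := not_lt.1 fun h => hu ⟨h, huv.trans_lt hv.2⟩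
      exact this.trans (e (K y)).2.1.le
    · rwa [extendFun_of_notMem _ _ hu, extendFun_of_notMem _ _ hv]

/-- Extension by the identity of order automorphisms of `(0, 1) ≃ ℝ`. -/
noncomputable def extendHom (e : ℝ ≃o Ioo (0 : ℝ) 1) : (ℝ ≃o ℝ) →* (ℝ ≃o ℝ) where
  toFun K := Equiv.toOrderIso
    { toFun := extendFun e K
      invFun := extendFun e K.symm
      left_inv := fun u => by
        rw [extendFun_comp, show (K.symm : ℝ → ℝ) ∘ K = id from K.symm_comp_self, extendFun_id]
      right_inv := fun u => by
        rw [extendFun_comp, show (K : ℝ → ℝ) ∘ K.symm = id from K.self_comp_symm, extendFun_id] }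
    (extendFun_monotone e K) (extendFun_monotone e K.symm)
  map_one' := by ext u; exact extendFun_id e u
  map_mul' K K' := by ext u; exact (extendFun_comp e K K' u).symm

theorem extendHom_apply (e : ℝ ≃o Ioo (0 : ℝ) 1) (K : ℝ ≃o ℝ) (u : ℝ) :
    extendHom e K u = extendFun e K u := rfl

/-- The restriction to `(0, 1) ≃ ℝ` of an order automorphism fixing `0` and `1`. -/
theorem exists_extendHom_eq (e : ℝ ≃o Ioo (0 : ℝ) 1) (H : ℝ ≃o ℝ)
    (hH : ∀ u, u ≤ 0 ∨ 1 ≤ u → H u = u) :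
    ∃ K : ℝ ≃o ℝ, extendHom e K = H ∧ ∀ x, (e (K x) : ℝ) = H (e x) := by
  have h0 : H 0 = 0 := hH 0 (Or.inl le_rfl)
  have h1 : H 1 = 1 := hH 1 (Or.inr le_rfl)
  have hm : ∀ u : Ioo (0 : ℝ) 1, H u ∈ Ioo (0 : ℝ) 1 := fun u =>
    ⟨h0.symm.trans_lt (H.strictMono u.2.1), (H.strictMono u.2.2).trans_eq h1⟩
  have hm' : ∀ u : Ioo (0 : ℝ) 1, H.symm u ∈ Ioo (0 : ℝ) 1 := fun u =>
    ⟨by rw [← H.lt_iff_lt, h0, H.apply_symm_apply]; exact u.2.1,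
      by rw [← H.lt_iff_lt, h1, H.apply_symm_apply]; exact u.2.2⟩
  let J : Ioo (0 : ℝ) 1 ≃o Ioo (0 : ℝ) 1 := Equiv.toOrderIso
    { toFun := fun u => ⟨H u, hm u⟩
      invFun := fun u => ⟨H.symm u, hm' u⟩
      left_inv := fun u => by simp
      right_inv := fun u => by simp }
    (fun u v h => H.monotone h) (fun u v h => H.symm.monotone h)
  have hJ : ∀ u, ((J u : Ioo (0 : ℝ) 1) : ℝ) = H u := fun u => rfl
  have key : ∀ x, (e ((e.trans (J.trans e.symm)) x) : ℝ) = H (e x) := fun x => by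
    simp [hJ]
  refine ⟨e.trans (J.trans e.symm), ?_, key⟩
  ext u
  rw [extendHom_apply]
  by_cases hu : u ∈ Ioo (0 : ℝ) 1
  · obtain ⟨x, hx⟩ := e.surjective ⟨u, hu⟩
    obtain rfl : (e x : ℝ) = u := by rw [hx]
    rw [extendFun_coe, key]
  · rw [extendFun_of_notMem _ _ hu, hH]
    by_contra! h
    exact hu h

/-- A family of order automorphisms supported in `[δ, 1 - δ]` is a family of commutators of order
automorphisms supported in `[0, 1]`, with a constant second entry, and a first entry which at each
point is a continuous function of a value of the family. -/
theorem exists_commutator_family {X : Type*} {δ : ℝ} (hδ : 0 < δ) (H : X → ℝ ≃o ℝ)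
    (hH : ∀ c u, u ≤ δ ∨ 1 - δ ≤ u → H c u = u) :
    ∃ (h : ℝ ≃o ℝ) (G : X → ℝ ≃o ℝ), (∀ u, u ≤ 0 ∨ 1 ≤ u → h u = u) ∧
      (∀ c u, u ≤ 0 ∨ 1 ≤ u → G c u = u) ∧ (∀ c, H c = ⁅G c, h⁆) ∧
      ∀ u, ∃ (w : ℝ) (E : ℝ → ℝ), ContinuousOn E (Ioo 0 1) ∧
        (∀ c, H c w ∈ Ioo (0 : ℝ) 1) ∧ ∀ c, G c u = E (H c w) := by
  obtain ⟨e, he0, he1⟩ := exists_lineIsoIoo hδ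
  have hH' : ∀ c u, u ≤ 0 ∨ 1 ≤ u → H c u = u := fun c u hu =>
    hH c u (hu.imp (fun h => h.trans hδ.le) fun h => by linarith)
  choose K hK hKe using fun c => exists_extendHom_eq e (H c) (hH' c)
  have hK1 : ∀ c x, x ≤ 0 ∨ 1 ≤ x → K c x = x := fun c x hx => by
    refine e.injective (Subtype.ext ?_)
    rw [hKe, hH]
    exact hx.imp (fun h => (Subtype.coe_le_coe.2 (e.monotone h)).trans he0)
      fun h => he1.trans (Subtype.coe_le_coe.2 (e.monotone h))
  choose R hR hRK using fun c => exists_repeat_commutator (hK1 c 0 (Or.inl le_rfl))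
    (hK1 c 1 (Or.inr le_rfl)) (hK1 c)
  have hout : ∀ (P : ℝ ≃o ℝ) u, u ≤ 0 ∨ 1 ≤ u → extendHom e P u = u := fun P u hu => by
    rw [extendHom_apply, extendFun_of_notMem]
    rintro ⟨h1, h2⟩
    rcases hu with h | h <;> linarith
  refine ⟨extendHom e translateOne, fun c => extendHom e (R c), hout _, fun c => hout _,
    fun c => ?_, fun u => ?_⟩
  · rw [← map_commutatorElement, ← hRK, hK]
  · by_cases hu : u ∈ Ioo (0 : ℝ) 1
    · obtain ⟨x, hx⟩ := e.surjective ⟨u, hu⟩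
      obtain rfl : (e x : ℝ) = u := by rw [hx]
      have hmem : ∀ c y, H c (e y) ∈ Ioo (0 : ℝ) 1 := fun c y => by
        rw [← hKe]; exact (e _).2
      rcases lt_or_ge x 0 with hx | hx
      · refine ⟨e x, fun _ => e x, continuousOn_const, fun c => hmem c x, fun c => ?_⟩
        rw [extendHom_apply, extendFun_coe, hR, repeatFun, if_pos hx]
      -- The repetition evaluates `K c` only at the fractional part of `x`, so `w` depends on `u`
      -- alone; `E` adds the integer part in the coordinate of the line.
      · refine ⟨e (Int.fract x), extendFun e fun y => ⌊x⌋ + y, ?_, fun c => hmem c _, fun c => ?_⟩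
        · rw [continuousOn_iff_continuous_domRestrict]
          have : (Ioo (0 : ℝ) 1).domRestrict (extendFun e fun y => ⌊x⌋ + y) =
              fun u => (e (⌊x⌋ + e.symm u) : ℝ) := by
            ext u
            rw [domRestrict_apply, extendFun, dif_pos u.2]
          rw [this]
          exact continuous_subtype_val.comp (e.continuous.comp
            (continuous_const.add e.symm.continuous))
        · rw [extendHom_apply, extendFun_coe, hR, repeatFun, if_neg hx.not_gt, ← hKe,
            extendFun_coe]
    -- Here `G c u = u` for all `c`; `e 0` is an arbitrary point of `(0, 1)`.
    · refine ⟨e 0, fun _ => u, continuousOn_const, fun c => ?_, fun c => ?_⟩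
      · rw [← hKe]; exact (e _).2
      · rw [extendHom_apply, extendFun_of_notMem _ _ hu]

end OrderAutomorphisms

/-! ### Flows with a totally disconnected transverse structure -/

/-- A free flow with dense orbits which is locally the product of the time with a totally
disconnected transverse direction; `V x` is the filter of transverse neighbourhoods of `x`. -/
structure IsTransverseTo {Ω : Type u} [TopologicalSpace Ω] (T : Flow ℝ Ω) (V : Ω → Filter Ω) :
    Prop where
  free : ∀ s x, T s x = x → s = 0
  dense : ∀ x, Dense (range fun s => T s x)
  tendsto : ∀ s x, Tendsto (T s) (V x) (V (T s x))
  -- Flow boxes: short times applied to a transverse neighbourhood sweep out a neighbourhood.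
  nhds_le : ∀ x, 𝓝 x ≤ map (fun p : ℝ × Ω => T p.1 p.2) (𝓝 0 ×ˢ V x)
  exists_section : ∀ x, ∀ U ∈ 𝓝 x, ∃ C ⊆ U, IsCompact C ∧ x ∈ C ∧ (∀ y ∈ C, 𝓝[C] y = V y) ∧
    ∃ η > 0, ∀ y ∈ C, ∀ s, |s| < η → T s y ∈ C → s = 0
  -- A connected subset of the box lies in one slice, on which `t` measures the time.
  exists_coord : ∀ x, ∃ N : Set Ω, IsOpen N ∧ x ∈ N ∧ ∃ t : Ω → ℝ, ContinuousOn t N ∧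
    ∀ S ⊆ N, IsPreconnected S → ∀ y ∈ S, ∀ z ∈ S, z = T (t z - t y) y

/-- The open-closed argument on a connected space, applied below mostly to a time parameter. -/
theorem forall_of_eventually_iff {X : Type*} [TopologicalSpace X] [PreconnectedSpace X]
    {p : X → Prop} (h : ∀ x, ∀ᶠ y in 𝓝 x, (p y ↔ p x)) {x₀ : X} (h₀ : p x₀) (x : X) : p x := by
  have h1 : IsLocallyConstant p :=
    (IsLocallyConstant.iff_eventually_eq p).2 fun x => (h x).mono fun y hy => propext hy
  exact (h1.apply_eq_of_preconnectedSpace x₀ x) ▸ h₀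

/-! ### Transverse filters and displacement functions -/

section FlowBasics

variable {Ω : Type u} [TopologicalSpace Ω] (T : Flow ℝ Ω)

theorem Flow.neg_apply_self (s : ℝ) (x : Ω) : T (-s) (T s x) = x := by
  rw [← T.map_add, neg_add_cancel, T.map_zero_apply]

theorem Flow.apply_neg_self (s : ℝ) (x : Ω) : T s (T (-s) x) = x := by
  rw [← T.map_add, add_neg_cancel, T.map_zero_apply]

theorem Flow.continuous_uncurry : Continuous fun p : ℝ × Ω => T p.1 p.2 := T.cont'

theorem Flow.continuous_apply_left (x : Ω) : Continuous fun s => T s x :=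
  T.continuous continuous_id continuous_const

variable {T} {V : Ω → Filter Ω}

namespace IsTransverseTo

theorem time_unique (hT : IsTransverseTo T V) {s t : ℝ} {x : Ω} (h : T s x = T t x) : s = t := by
  have : T (-t + s) x = x := by rw [T.map_add, h, T.neg_apply_self]
  linarith [hT.free _ _ this]

theorem le_nhds (hT : IsTransverseTo T V) (x : Ω) : V x ≤ 𝓝 x := by
  obtain ⟨C, -, -, hx, hC, -⟩ := hT.exists_section x univ univ_mem
  rw [← hC x hx]
  exact nhdsWithin_le_nhds

/-- The inverse `T (-s)` respects the transverse filters too, so `tendsto` is in fact an equality of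
filters. -/
theorem le_map (hT : IsTransverseTo T V) (s : ℝ) (x : Ω) : V (T s x) ≤ map (T s) (V x) := by
  have h := hT.tendsto (-s) (T s x)
  rw [T.neg_apply_self] at h
  have h2 : map (T s) (map (T (-s)) (V (T s x))) = V (T s x) := by
    rw [map_map, show (T s) ∘ (T (-s)) = id from funext fun y => T.apply_neg_self s y, map_id]
  rw [← h2]
  exact map_mono h

theorem tendsto_of_displacement (hT : IsTransverseTo T V) {f : Ω → Ω} {α : Ω → ℝ} (hα : ∀ x, f x = T (α x) x)
    {x : Ω} (h : ∀ᶠ y in V x, α y = α x) : Tendsto f (V x) (V (f x)) := by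
  rw [hα x]
  exact (hT.tendsto (α x) x).congr' (h.mono fun y hy => by rw [hα y, hy])

/-- For `y` transversally close to `x`, both `y` and `T (α y - α x) y` lie in one section, whose
nonzero return times are at least `η`. As `α` is continuous, the time `α y - α x` is below `η`,
hence zero. -/
theorem displacement_of_tendsto (hT : IsTransverseTo T V) {f : Ω → Ω} {α : Ω → ℝ} (hc : Continuous α)
    (hα : ∀ x, f x = T (α x) x) {x : Ω} (h : Tendsto f (V x) (V (f x))) :
    ∀ᶠ y in V x, α y = α x := by
  obtain ⟨C, -, -, hx, hC, η, hη, H⟩ := hT.exists_section x univ univ_mem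
  have h1 : ∀ᶠ y in V x, T (-α x) (f y) ∈ C := by
    have h2 : Tendsto (fun y => T (-α x) (f y)) (V x) (V x) := by
      have := (hT.tendsto (-α x) (f x)).comp h
      rwa [hα x, T.neg_apply_self] at this
    refine h2.eventually ?_
    rw [← hC x hx]
    exact self_mem_nhdsWithin
  have h2 : ∀ᶠ y in V x, y ∈ C := by rw [← hC x hx]; exact self_mem_nhdsWithin
  have h3 : ∀ᶠ y in V x, |α y - α x| < η :=
    hT.le_nhds x ((hc.continuousAt.eventually (Metric.ball_mem_nhds (α x) hη)))
  filter_upwards [h1, h2, h3] with y h1 h2 h3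
  rw [hα y, ← T.map_add] at h1
  have := H y h2 (-α x + α y) (by rwa [neg_add_eq_sub]) h1
  linarith

end IsTransverseTo

end FlowBasics

/-! ### Regularity of displacement functions, and isotopies -/

section Displacement

variable {Ω : Type u} [MetricSpace Ω] {T : Flow ℝ Ω} {V : Ω → Filter Ω} {α : Ω → ℝ}

namespace IsTransverseTo

/-- Along the flow, the displacement function of an orbit-preserving map varies continuously. -/
theorem displacement_along (hT : IsTransverseTo T V) {f : Ω → Ω} (hf : Continuous f)
    (hα : ∀ x, f x = T (α x) x) (x : Ω) : ∀ᶠ s in 𝓝 (0 : ℝ),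
      (ContinuousAt α (T s x) ↔ ContinuousAt α x) := by
  obtain ⟨N, hN, hxN, t, ht, H⟩ := hT.exists_coord (f x)
  have hc : Continuous fun p : ℝ × Ω => f (T p.1 p.2) := hf.comp T.continuous_uncurry
  have h1 : ∀ᶠ p : ℝ × Ω in 𝓝 (0, x), f (T p.1 p.2) ∈ N :=
    hc.continuousAt.eventually (hN.mem_nhds (by simpa using hxN))
  rw [nhds_prod_eq, eventually_prod_iff] at h1
  obtain ⟨pa, hpa, pb, hpb, h1⟩ := h1
  obtain ⟨ε, hε, hεp⟩ := Metric.eventually_nhds_iff_ball.1 hpa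
  have h0 : (0 : ℝ) ∈ Metric.ball (0 : ℝ) ε := Metric.mem_ball_self hε
  -- The curve `r ↦ f (T r y)` stays in the box `N`, hence in one slice, where `t` gives the elapsed
  -- time. So `α (T s y)` and `α y` differ by a term which is continuous at `x`.
  have key : ∀ s ∈ Metric.ball (0 : ℝ) ε, ∀ y, pb y →
      α (T s y) = α y + (t (f (T s y)) - t (f y) - s) := by
    intro s hs y hy
    have hS : IsPreconnected ((fun s => f (T s y)) '' Metric.ball 0 ε) :=
      (convex_ball _ _).isPreconnected.image _
        (hf.comp (T.continuous_apply_left y)).continuousOn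
    have h := H _ (by rintro _ ⟨r, hr, rfl⟩; exact h1 (hεp r hr) hy) hS _
      (mem_image_of_mem _ h0) _ (mem_image_of_mem _ hs)
    simp only [T.map_zero_apply] at h
    have h' : T (α (T s y) + s) y = T (t (f (T s y)) - t (f y) + α y) y := by
      rw [T.map_add, T.map_add, ← hα, ← hα]
      exact h
    have := hT.time_unique h'
    linarith
  have hca : ∀ s ∈ Metric.ball (0 : ℝ) ε,
      ContinuousAt (fun y => t (f (T s y)) - t (f y) - s) x := by
    intro s hs
    have e1 : ContinuousAt t (f (T s x)) :=
      ht.continuousAt (hN.mem_nhds (h1 (hεp s hs) hpb.self_of_nhds))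
    have e2 : ContinuousAt t (f x) := ht.continuousAt (hN.mem_nhds hxN)
    have e3 : ContinuousAt (fun y => t (f (T s y))) x :=
      ContinuousAt.comp (f := fun y => f (T s y)) e1 (hf.comp (T.continuous_toFun s)).continuousAt
    have e4 : ContinuousAt (fun y => t (f y)) x := ContinuousAt.comp (f := f) e2 hf.continuousAt
    exact (e3.sub e4).sub continuousAt_const
  filter_upwards [Metric.ball_mem_nhds (0 : ℝ) hε] with s hs
  have e : (fun y => α (T s y)) =ᶠ[𝓝 x] fun y => α y + (t (f (T s y)) - t (f y) - s) :=
    hpb.mono fun y hy => key s hs y hy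
  constructor
  · intro h
    have h2 : ContinuousAt (fun y => α (T s y)) x :=
      ContinuousAt.comp (f := T s) h (T.continuous_toFun s).continuousAt
    have h3 := (h2.congr e).sub (hca s hs)
    refine h3.congr (Eventually.of_forall fun y => ?_)
    simp
  · intro h
    have h2 : ContinuousAt (fun y => α (T s y)) x := (h.add (hca s hs)).congr e.symm
    have h3 : ContinuousAt ((fun y => α (T s y)) ∘ T (-s)) (T s x) :=
      ContinuousAt.comp (by rwa [T.neg_apply_self]) (T.continuous_toFun (-s)).continuousAt
    refine h3.congr (Eventually.of_forall fun y => ?_)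
    simp [T.apply_neg_self]

/-- The displacement function of a continuous orbit-preserving map is continuous. -/
theorem continuous_displacement [CompactSpace Ω] (hT : IsTransverseTo T V) {f : Ω → Ω} (hf : Continuous f)
    (hα : ∀ x, f x = T (α x) x) : Continuous α := by
  rw [continuous_iff_continuousAt]
  intro x
  have : Nonempty Ω := ⟨x⟩
  -- Baire: the closed sets of points displaced by at most `n` cover `Ω`, so one of them has
  -- interior.
  let F : ℕ → Set Ω := fun n => {y | ∃ r ∈ Icc (-n : ℝ) n, f y = T r y}
  have hrel : IsClosed {p : ℝ × Ω | f p.2 = T p.1 p.2} :=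
    isClosed_eq (hf.comp continuous_snd) T.continuous_uncurry
  have hF : ∀ n, IsClosed (F n) := by
    intro n
    have h1 : IsCompact ((Icc (-n : ℝ) n ×ˢ (univ : Set Ω)) ∩ {p : ℝ × Ω | f p.2 = T p.1 p.2}) :=
      (isCompact_Icc.prod isCompact_univ).inter_right hrel
    have h2 : F n = Prod.snd '' ((Icc (-n : ℝ) n ×ˢ (univ : Set Ω)) ∩
        {p : ℝ × Ω | f p.2 = T p.1 p.2}) := by
      ext y
      constructor
      · rintro ⟨r, hr, h⟩; exact ⟨(r, y), ⟨⟨hr, trivial⟩, h⟩, rfl⟩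
      · rintro ⟨⟨r, z⟩, ⟨⟨hr, -⟩, h⟩, rfl⟩; exact ⟨r, hr, h⟩
    rw [h2]
    exact (h1.image continuous_snd).isClosed
  have hU : ⋃ n, F n = univ := by
    refine eq_univ_of_forall fun y => mem_iUnion.2 ?_
    obtain ⟨n, hn⟩ := exists_nat_ge |α y|
    exact ⟨n, α y, abs_le.1 hn, hα y⟩
  obtain ⟨n, z, hz⟩ := nonempty_interior_of_iUnion_of_closed hF hU
  have hcont : ∀ y ∈ interior (F n), ContinuousAt α y := by
    intro y hy
    -- Near `y` the function `α` is bounded. A cluster value `r` satisfies `f y = T r y` by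
    -- closedness of the relation, and freeness forces `r = α y`.
    refine IsCompact.tendsto_nhds_of_unique_mapClusterPt (isCompact_Icc (a := (-n : ℝ)) (b := n))
      ?_ fun r _ hr => ?_
    · filter_upwards [isOpen_interior.mem_nhds hy] with w hw
      obtain ⟨r, hr, h⟩ := interior_subset hw
      rw [hα w] at h
      rwa [hT.time_unique h]
    · by_contra hne
      have h1 : ∀ᶠ p : ℝ × Ω in 𝓝 (r, y), ¬ f p.2 = T p.1 p.2 := by
        refine hrel.isOpen_compl.mem_nhds fun h => hne ?_
        change f y = T r y at h
        rw [hα y] at h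
        exact (hT.time_unique h).symm
      rw [nhds_prod_eq, eventually_prod_iff] at h1
      obtain ⟨pa, hpa, pb, hpb, h1⟩ := h1
      obtain ⟨w, hw, hw'⟩ := ((mapClusterPt_iff_frequently.1 hr _ hpa).and_eventually hpb).exists
      exact h1 hw hw' (hα w)
  -- The dense orbit of `x` meets this interior, and continuity propagates along the orbit back to
  -- `x`.
  obtain ⟨_, hs, s, rfl⟩ := (hT.dense x).inter_open_nonempty _ isOpen_interior ⟨z, hz⟩
  have hloc : ∀ s₀ : ℝ, ∀ᶠ s in 𝓝 s₀, (ContinuousAt α (T s x) ↔ ContinuousAt α (T s₀ x)) := by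
    intro s₀
    have h := hT.displacement_along hf hα (T s₀ x)
    have ht : Tendsto (fun s => s - s₀) (𝓝 s₀) (𝓝 0) := by
      have : Continuous fun s : ℝ => s - s₀ := by fun_prop
      simpa using this.tendsto s₀
    filter_upwards [ht.eventually h] with s hs
    rwa [← T.map_add, sub_add_cancel] at hs
  have := forall_of_eventually_iff (p := fun s => ContinuousAt α (T s x)) hloc
    (hcont _ hs) 0
  simpa using this

theorem exists_bound [CompactSpace Ω] (hα : Continuous α) : ∃ A > 0, ∀ x, |α x| ≤ A := by
  obtain ⟨A, hA⟩ := isCompact_univ.exists_bound_of_continuousOn hα.continuousOn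
  exact ⟨max A 1, by positivity, fun x => (hA x trivial).trans (le_max_left _ _)⟩

/-- A continuous injective orbit-preserving map is increasing on the orbits. -/
theorem strictMono_displacement [CompactSpace Ω] (hT : IsTransverseTo T V) {f : Ω → Ω} (hf : Continuous f)
    (hinj : Function.Injective f) (hα : ∀ x, f x = T (α x) x) (x : Ω) :
    StrictMono fun s => s + α (T s x) := by
  have hc := hT.continuous_displacement hf hα
  have hcont : Continuous fun s => s + α (T s x) :=
    continuous_id.add (hc.comp (T.continuous_apply_left x))
  have hval : ∀ s, f (T s x) = T (s + α (T s x)) x := fun s => by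
    rw [hα, ← T.map_add, add_comm]
  have hi : Function.Injective fun s => s + α (T s x) := by
    intro s s' h
    have h2 : f (T s x) = f (T s' x) := by rw [hval, hval]; exact congrArg (fun r => T r x) h
    exact hT.time_unique (hinj h2)
  -- A decreasing map is excluded by boundedness: the value at `2A + 1` is at least `A + 1`, the
  -- value at `0` at most `A`.
  refine (hcont.strictMono_of_inj hi).resolve_right fun ha => ?_
  obtain ⟨A, hA, hb⟩ := exists_bound hc
  have h1 := ha (show (0 : ℝ) < 2 * A + 1 by linarith)
  simp only at h1
  have h2 := abs_le.1 (hb (T 0 x))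
  have h3 := abs_le.1 (hb (T (2 * A + 1) x))
  linarith

/-- A continuous function which is increasing on the orbits is the displacement function of a
homeomorphism. -/
theorem exists_homeomorph [CompactSpace Ω] (hα : Continuous α)
    (hm : ∀ x, StrictMono fun s => s + α (T s x)) :
    ∃ f : Ω ≃ₜ Ω, ∀ x, f x = T (α x) x := by
  have hf : Continuous fun x => T (α x) x := T.continuous hα continuous_id
  have hbij : Function.Bijective fun x => T (α x) x := by
    constructor
    · intro x y h
      have hy : y = T (-α y + α x) x := by
        rw [T.map_add]; simp only at h; rw [h, T.neg_apply_self]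
      have h2 : (-α y + α x) + α (T (-α y + α x) x) = 0 + α (T 0 x) := by
        rw [← hy, T.map_zero_apply]; ring
      have h3 := (hm x).injective h2
      rw [h3, T.map_zero_apply] at hy
      exact hy.symm
    · intro y
      obtain ⟨A, hA, hb⟩ := exists_bound hα
      have hcont : Continuous fun s => s + α (T s y) :=
        continuous_id.add (hα.comp (T.continuous_apply_left y))
      have hsurj : Function.Surjective fun s => s + α (T s y) :=
        hcont.surjective
          (tendsto_atTop_add_right_of_le _ (-A) tendsto_id fun s => (abs_le.1 (hb _)).1)
          (tendsto_atBot_add_right_of_ge _ A tendsto_id fun s => (abs_le.1 (hb _)).2)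
      obtain ⟨s, hs⟩ := hsurj 0
      refine ⟨T s y, ?_⟩
      simp only at hs ⊢
      rw [← T.map_add, add_comm, hs, T.map_zero_apply]
  exact ⟨hf.homeoOfEquivCompactToT2 (f := Equiv.ofBijective _ hbij), fun x => rfl⟩

/-- An orbit-preserving homeomorphism is joined to the identity by moving along the orbits. -/
theorem exists_isotopy [CompactSpace Ω] (hT : IsTransverseTo T V) {f : Ω ≃ₜ Ω} (hα : ∀ x, f x = T (α x) x) :
    ∃ γ : unitInterval → Ω ≃ₜ Ω, Continuous γ ∧ γ 0 = 1 ∧ γ 1 = f ∧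
      ∀ t x, γ t x = T (t * α x) x := by
  have hc := hT.continuous_displacement f.continuous hα
  have hm := hT.strictMono_displacement f.continuous f.injective hα
  have hex : ∀ t : unitInterval, ∃ g : Ω ≃ₜ Ω, ∀ x, g x = T (t * α x) x := by
    intro t
    -- `s + t α` is the convex combination `(1 - t) s + t (s + α)` of increasing functions.
    refine exists_homeomorph (α := fun x => t * α x) (continuous_const.mul hc)
      fun x s s' h => ?_
    have h1 := hm x h
    simp only at h1 ⊢
    have ht := t.2.1
    have ht' := t.2.2
    rcases ht.eq_or_lt with h0 | h0
    · rw [← h0]; simpa using h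
    · nlinarith [mul_lt_mul_of_pos_left h1 h0, mul_le_mul_of_nonneg_left h.le (sub_nonneg.2 ht')]
  choose γ hγ using hex
  have hcu : Continuous fun p : unitInterval × Ω => γ p.1 p.2 := by
    simp only [hγ]
    exact T.continuous ((continuous_subtype_val.comp continuous_fst).mul
      (hc.comp continuous_snd)) continuous_snd
  -- Joint continuity of the inverses: the fibrewise map is a continuous bijection of a compact
  -- Hausdorff space.
  let e : unitInterval × Ω ≃ unitInterval × Ω :=
    { toFun := fun p => (p.1, γ p.1 p.2)
      invFun := fun p => (p.1, (γ p.1).symm p.2)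
      left_inv := fun p => by simp
      right_inv := fun p => by simp }
  have he : Continuous e := continuous_fst.prodMk hcu
  have hcu' : Continuous fun p : unitInterval × Ω => (γ p.1).symm p.2 :=
    continuous_snd.comp (he.homeoOfEquivCompactToT2).symm.continuous
  refine ⟨γ, ?_, ?_, ?_, hγ⟩
  · refine isInducing_homeoPair.continuous_iff.2 (Continuous.prodMk ?_ ?_)
    · exact ContinuousMap.continuous_of_continuous_uncurry _ hcu
    · exact ContinuousMap.continuous_of_continuous_uncurry _ hcu'
  · ext x; simp [hγ]
  · ext x; simp [hγ, hα]

end IsTransverseTo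

end Displacement

/-! ### Cross-sections -/

/-- A compact cross-section `C` of the flow, whose return times are at least `R`. -/
structure IsCrossSection {Ω : Type u} [TopologicalSpace Ω] (T : Flow ℝ Ω) (V : Ω → Filter Ω)
    (C : Set Ω) (R : ℝ) : Prop where
  isCompact : IsCompact C
  pos : 0 < R
  nhds_eq : ∀ y ∈ C, 𝓝[C] y = V y
  gap : ∀ y ∈ C, ∀ s, |s| < R → T s y ∈ C → s = 0
  hits : ∃ M, ∀ x, ∃ s ∈ Icc 0 M, T s x ∈ C

section CrossSection

variable {Ω : Type u} [MetricSpace Ω] {T : Flow ℝ Ω} {V : Ω → Filter Ω} {C : Set Ω} {R : ℝ}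

/-- The set swept by `C` in times below `1` is a neighbourhood of `x₀`. Every orbit enters its
interior by density, and compactness bounds the time needed. -/
theorem IsTransverseTo.exists_hitting_time [CompactSpace Ω] (hT : IsTransverseTo T V) {x₀ : Ω}
    (hC : 𝓝[C] x₀ = V x₀) : ∃ M, ∀ x, ∃ s ∈ Icc 0 M, T s x ∈ C := by
  set W : Set Ω := {z | ∃ s, |s| < 1 ∧ T s z ∈ C} with hW
  have hWx : W ∈ 𝓝 x₀ := by
    refine hT.nhds_le x₀ (mem_map.2 ?_)
    have h1 : ∀ᶠ s : ℝ in 𝓝 0, |s| < 1 := by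
      filter_upwards [Metric.ball_mem_nhds (0 : ℝ) one_pos] with s hs
      simpa using hs
    have h2 : ∀ᶠ y in V x₀, y ∈ C := by rw [← hC]; exact self_mem_nhdsWithin
    filter_upwards [h1.prod_mk h2] with p hp
    exact ⟨-p.1, by rw [abs_neg]; exact hp.1, by rw [T.neg_apply_self]; exact hp.2⟩
  obtain ⟨t, ht⟩ := isCompact_univ.elim_finite_subcover
    (fun s : ℝ => T s ⁻¹' interior W)
    (fun s => isOpen_interior.preimage (T.continuous_toFun s)) fun x _ => by
      obtain ⟨_, h, s, rfl⟩ := (hT.dense x).inter_open_nonempty _ isOpen_interior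
        ⟨x₀, mem_interior_iff_mem_nhds.2 hWx⟩
      exact mem_iUnion.2 ⟨s, h⟩
  obtain ⟨M, hM⟩ := (t.image fun s => |s|).exists_le
  refine ⟨2 * M + 2, fun x => ?_⟩
  -- Starting from `T (M + 1) x` makes the total time nonnegative, since `|s| ≤ M` and `|s'| < 1`.
  obtain ⟨s, hs⟩ := mem_iUnion.1 (ht (mem_univ (T (M + 1) x)))
  obtain ⟨hst, hs⟩ := mem_iUnion.1 hs
  obtain ⟨s', hs', h⟩ := interior_subset hs
  have h1 := abs_le.1 (hM _ (Finset.mem_image_of_mem _ hst))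
  have h2 := abs_lt.1 hs'
  refine ⟨s' + (s + (M + 1)), ⟨by linarith, by linarith⟩, ?_⟩
  rwa [T.map_add, T.map_add]

/-- The section `C₀` has no return at nonzero times below `η`. For `η ≤ |s| ≤ R`, freeness and
compactness of this set of times give a neighbourhood `U` of `x₀` without returns; shrinking `C₀`
into `U` excludes those as well. -/
theorem IsTransverseTo.exists_isCrossSection [CompactSpace Ω] [Nonempty Ω] (hT : IsTransverseTo T V) (hR : 0 < R) :
    ∃ C, C.Nonempty ∧ IsCrossSection T V C R := by
  obtain ⟨x₀⟩ := ‹Nonempty Ω›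
  obtain ⟨C₀, -, hC₀, hx₀, hV₀, η, hη, hη₀⟩ := hT.exists_section x₀ univ univ_mem
  have hK : IsCompact {s : ℝ | s ∈ Icc (-R) R ∧ η ≤ |s|} :=
    isCompact_Icc.inter_right (isClosed_le continuous_const continuous_abs)
  have h1 : ∀ᶠ p : Ω × Ω in 𝓝 (x₀, x₀), ∀ s ∈ {s : ℝ | s ∈ Icc (-R) R ∧ η ≤ |s|},
      T s p.1 ≠ p.2 := by
    refine hK.eventually_forall_of_forall_eventually fun s hs => ?_
    have ho : IsOpen {q : (Ω × Ω) × ℝ | T q.2 q.1.1 ≠ q.1.2} :=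
      isOpen_ne_fun (T.continuous continuous_snd (continuous_fst.comp continuous_fst))
        (continuous_snd.comp continuous_fst)
    refine ho.mem_nhds fun h => ?_
    have := hs.2
    rw [hT.free s x₀ h, abs_zero] at this
    linarith
  rw [nhds_prod_eq] at h1
  obtain ⟨U, hU, hUU⟩ := mem_prod_self_iff.1 h1
  obtain ⟨C₁, hC₁U, hC₁, hx₁, hV₁, -⟩ := hT.exists_section x₀ U hU
  have hV : ∀ y ∈ C₀ ∩ C₁, 𝓝[C₀ ∩ C₁] y = V y := fun y hy => by
    rw [nhdsWithin_inter, hV₀ y hy.1, hV₁ y hy.2, inf_idem]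
  refine ⟨C₀ ∩ C₁, ⟨x₀, hx₀, hx₁⟩, hC₀.inter hC₁, hR, hV, fun y hy s hs hsy => ?_,
    hT.exists_hitting_time (hV _ ⟨hx₀, hx₁⟩)⟩
  by_contra h0
  rcases lt_or_ge |s| η with h | h
  · exact h0 (hη₀ y hy.1 s h hsy.1)
  · exact hUU (mk_mem_prod (hC₁U hy.2) (hC₁U hsy.2)) s ⟨abs_le.1 hs.le, h⟩ rfl

namespace IsCrossSection

theorem translate (hT : IsTransverseTo T V) (hC : IsCrossSection T V C R) (a : ℝ) :
    IsCrossSection T V (T a '' C) R where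
  isCompact := hC.isCompact.image (T.continuous_toFun a)
  pos := hC.pos
  nhds_eq := by
    rintro _ ⟨y, hy, rfl⟩
    have h : map (T a) (𝓝[C] y) = 𝓝[T a '' C] (T a y) :=
      (T.toHomeomorph a).isEmbedding.map_nhdsWithin_eq C y
    rw [← h, hC.nhds_eq y hy]
    exact le_antisymm (hT.tendsto a y) (hT.le_map a y)
  gap := by
    rintro _ ⟨y, hy, rfl⟩ s hs ⟨z, hz, h⟩
    refine hC.gap y hy s hs ?_
    rw [← T.map_add, add_comm, T.map_add] at h
    rwa [← (T.toHomeomorph a).injective h]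
  hits := by
    obtain ⟨M, hM⟩ := hC.hits
    refine ⟨M, fun x => ?_⟩
    obtain ⟨s, hs, h⟩ := hM (T (-a) x)
    exact ⟨s, hs, _, h, by rw [← T.map_add, ← T.map_add]; congr 1; ring⟩

/-- The hitting times vary in a locally constant way in the transverse direction. -/
theorem eventually_mem_iff (hT : IsTransverseTo T V) (hC : IsCrossSection T V C R) (x : Ω) (M : ℝ) :
    ∀ᶠ y in V x, ∀ s ∈ Icc (-M) M, (T s y ∈ C ↔ T s x ∈ C) := by
  have h : {p : Ω × ℝ | T p.2 p.1 ∈ C ↔ T p.2 x ∈ C} ∈ V x ×ˢ 𝓝ˢ (Icc (-M) M) := by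
    refine isCompact_Icc.mem_prod_nhdsSet_of_forall fun s _ => ?_
    -- By compactness of the time interval it is enough to look near one time `s`. If `s` is a hit
    -- of `x`, it is one for nearby `y`, and the gap makes it the only hit near `s` for both;
    -- otherwise closedness of `C` excludes hits.
    by_cases hs : T s x ∈ C
    · have h1 : ∀ᶠ y in V x, T s y ∈ C := by
        refine (hT.tendsto s x).eventually ?_
        rw [← hC.nhds_eq _ hs]
        exact self_mem_nhdsWithin
      have h2 : ∀ᶠ s' in 𝓝 s, |s' - s| < R := Metric.ball_mem_nhds s hC.pos
      filter_upwards [h1.prod_mk h2] with p hp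
      have key : ∀ z, T s z ∈ C → (T p.2 z ∈ C ↔ p.2 = s) := fun z hz => by
        constructor
        · intro h
          have := hC.gap _ hz (p.2 - s) hp.2 (by rwa [← T.map_add, sub_add_cancel])
          linarith
        · intro h; rwa [h]
      exact (key _ hp.1).trans (key _ hs).symm
    · have ho : IsOpen {p : Ω × ℝ | T p.2 p.1 ∉ C} :=
        hC.isCompact.isClosed.isOpen_compl.preimage (T.continuous continuous_snd continuous_fst)
      have h1 : ∀ᶠ p in V x ×ˢ 𝓝 s, T p.2 p.1 ∉ C := by
        have : ∀ᶠ p in 𝓝 (x, s), T p.2 p.1 ∉ C := ho.mem_nhds hs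
        rw [nhds_prod_eq] at this
        exact prod_mono_left _ (hT.le_nhds x) this
      have h2 : ∀ᶠ s' in 𝓝 s, T s' x ∉ C :=
        (T.continuous_apply_left x).continuousAt.eventually
          (hC.isCompact.isClosed.isOpen_compl.mem_nhds hs)
      filter_upwards [h1, (Eventually.of_forall (p := fun _ => True) fun _ => trivial).prod_mk h2]
        with p hp hp'
      exact iff_of_false hp hp'.2
  obtain ⟨t₁, h₁, t₂, h₂, ht⟩ := mem_prod_iff.1 h
  filter_upwards [h₁] with y hy s hs
  exact ht (mk_mem_prod hy (subset_of_mem_nhdsSet h₂ hs))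

end IsCrossSection

/-! ### Distance to a cross-section, bump functions and fragmentation -/

/-- The distance to `C` along the orbits. -/
noncomputable def orbitDist (T : Flow ℝ Ω) (C : Set Ω) (x : Ω) : ℝ :=
  sInf ((fun s => |s|) '' {s | T s x ∈ C})

theorem orbitDist_nonneg (x : Ω) : 0 ≤ orbitDist T C x :=
  Real.sInf_nonneg (by rintro _ ⟨s, -, rfl⟩; exact abs_nonneg s)

theorem orbitDist_le {x : Ω} {s : ℝ} (h : T s x ∈ C) : orbitDist T C x ≤ |s| :=
  csInf_le ⟨0, by rintro _ ⟨s, -, rfl⟩; exact abs_nonneg s⟩ ⟨s, h, rfl⟩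

namespace IsCrossSection

/-- `hits` is essential: on an orbit missing `C` the infimum would be the default value `0`. -/
theorem exists_of_orbitDist_lt (hC : IsCrossSection T V C R) {x : Ω} {b : ℝ}
    (h : orbitDist T C x < b) : ∃ s, |s| < b ∧ T s x ∈ C := by
  obtain ⟨M, hM⟩ := hC.hits
  obtain ⟨s₀, -, hs₀⟩ := hM x
  obtain ⟨_, ⟨s, hs, rfl⟩, hb⟩ := exists_lt_of_csInf_lt (Set.Nonempty.image _ ⟨s₀, hs₀⟩) h
  exact ⟨s, hb, hs⟩

theorem orbitDist_apply_le (hC : IsCrossSection T V C R) (a : ℝ) (x : Ω) :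
    orbitDist T C (T a x) ≤ orbitDist T C x + |a| := by
  refine le_of_forall_gt_imp_ge_of_dense fun b hb => ?_
  obtain ⟨s, hs, h⟩ := hC.exists_of_orbitDist_lt (show orbitDist T C x < b - |a| by linarith)
  have h1 : T (s - a) (T a x) ∈ C := by rwa [← T.map_add, sub_add_cancel]
  linarith [orbitDist_le h1, abs_sub s a]

theorem abs_orbitDist_sub_le (hC : IsCrossSection T V C R) (a : ℝ) (x : Ω) :
    |orbitDist T C (T a x) - orbitDist T C x| ≤ |a| := by
  have h1 := hC.orbitDist_apply_le a x
  have h2 := hC.orbitDist_apply_le (-a) (T a x)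
  rw [T.neg_apply_self, abs_neg] at h2
  rw [abs_le]
  constructor <;> linarith

/-- The hits in the time window of radius `orbitDist T C x + 1` determine the distance, and
transversally close points have the same hits there. -/
theorem eventually_orbitDist_eq (hT : IsTransverseTo T V) (hC : IsCrossSection T V C R) (x : Ω) :
    ∀ᶠ y in V x, orbitDist T C y = orbitDist T C x := by
  have h0 := orbitDist_nonneg (T := T) (C := C) x
  filter_upwards [hC.eventually_mem_iff hT x (orbitDist T C x + 1)] with y hy
  refine le_antisymm ?_ ?_ <;> by_contra! h
  · obtain ⟨s, hs, hsC⟩ := hC.exists_of_orbitDist_lt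
      (lt_min h (show orbitDist T C x < orbitDist T C x + 1 by linarith))
    have h1 := (hy s (abs_le.1 (hs.le.trans (min_le_right _ _)))).2 hsC
    exact (orbitDist_le h1).not_gt (hs.trans_le (min_le_left _ _))
  · obtain ⟨s, hs, hsC⟩ := hC.exists_of_orbitDist_lt h
    have h1 := (hy s (abs_le.1 (by linarith))).1 hsC
    exact (orbitDist_le h1).not_gt hs

end IsCrossSection

/-- A transversally locally constant function which is Lipschitz along the orbits is continuous. -/
theorem IsTransverseTo.continuous_of_lipschitz (hT : IsTransverseTo T V) {θ : Ω → ℝ} {K : ℝ}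
    (h1 : ∀ x, ∀ᶠ y in V x, θ y = θ x) (h2 : ∀ s x, |θ (T s x) - θ x| ≤ K * |s|) :
    Continuous θ := by
  rw [continuous_iff_continuousAt]
  intro x
  refine Tendsto.mono_left ?_ (hT.nhds_le x)
  rw [tendsto_map'_iff, tendsto_iff_dist_tendsto_zero]
  have h3 : Tendsto (fun p : ℝ × Ω => K * |p.1|) (𝓝 0 ×ˢ V x) (𝓝 0) := by
    have : Continuous fun s : ℝ => K * |s| := by fun_prop
    have h := (this.tendsto 0).comp (tendsto_fst (f := 𝓝 (0 : ℝ)) (g := V x))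
    simpa [Function.comp_def] using h
  refine squeeze_zero' (Eventually.of_forall fun _ => dist_nonneg) ?_ h3
  filter_upwards [(Eventually.of_forall (p := fun _ : ℝ => True) fun _ => trivial).prod_mk (h1 x)]
    with p hp
  simp only [Function.comp_apply, Real.dist_eq]
  rw [← hp.2]
  exact h2 _ _

/-- A bump function around a cross-section. -/
theorem IsCrossSection.exists_bump (hT : IsTransverseTo T V) (hC : IsCrossSection T V C R) {L : ℝ}
    (hL : 0 < L) : ∃ θ : Ω → ℝ, Continuous θ ∧ (∀ x, 0 ≤ θ x) ∧
      (∀ x, ∀ᶠ y in V x, θ y = θ x) ∧ (∀ s x, |θ (T s x) - θ x| ≤ L⁻¹ * |s|) ∧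
      (∀ y ∈ C, ∀ s, |s| ≤ L → θ (T s y) = 1) ∧
      ∀ x, (∀ s, |s| < 2 * L → T s x ∉ C) → θ x = 0 := by
  -- `θ` is `1` up to distance `L` from `C`, `0` from distance `2 * L` on, and affine of slope
  -- `-L⁻¹` in the distance in between.
  set θ : Ω → ℝ := fun x => max 0 (min 1 (2 - L⁻¹ * orbitDist T C x)) with hθ
  have hloc : ∀ x, ∀ᶠ y in V x, θ y = θ x := fun x =>
    (hC.eventually_orbitDist_eq hT x).mono fun y hy => by simp only [hθ, hy]
  have hlip : ∀ s x, |θ (T s x) - θ x| ≤ L⁻¹ * |s| := fun s x => by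
    refine (abs_max_sub_max_le_max _ _ _ _).trans (max_le (by simp; positivity) ?_)
    refine (abs_min_sub_min_le_max _ _ _ _).trans (max_le (by simp; positivity) ?_)
    rw [show 2 - L⁻¹ * orbitDist T C (T s x) - (2 - L⁻¹ * orbitDist T C x) =
      L⁻¹ * -(orbitDist T C (T s x) - orbitDist T C x) by ring, abs_mul, abs_neg,
      abs_of_pos (inv_pos.2 hL)]
    exact mul_le_mul_of_nonneg_left (hC.abs_orbitDist_sub_le s x) (inv_pos.2 hL).le
  refine ⟨θ, hT.continuous_of_lipschitz hloc hlip, fun x => le_max_left _ _, hloc, hlip,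
    fun y hy s hs => ?_, fun x hx => ?_⟩
  · have h1 : T (-s) (T s y) ∈ C := by rwa [T.neg_apply_self]
    have h2 := orbitDist_le h1
    rw [abs_neg] at h2
    have h3 : L⁻¹ * orbitDist T C (T s y) ≤ 1 := by
      rw [inv_mul_le_iff₀ hL]; linarith
    simp only [hθ]
    rw [min_eq_left (by linarith), max_eq_right zero_le_one]
  · have h1 : 2 * L ≤ orbitDist T C x := by
      by_contra! h
      obtain ⟨s, hs, h'⟩ := hC.exists_of_orbitDist_lt h
      exact hx s hs h'
    have h2 : 2 ≤ L⁻¹ * orbitDist T C x := by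
      rw [le_inv_mul_iff₀ hL]; linarith
    simp only [hθ]
    exact max_eq_left ((min_le_right _ _).trans (by linarith))

/-- Every orbit-preserving homeomorphism agrees, near a cross-section, with an orbit-preserving
homeomorphism which is the identity near another cross-section. -/
theorem IsTransverseTo.exists_fragment [CompactSpace Ω] [Nonempty Ω] (hT : IsTransverseTo T V) {f : Ω ≃ₜ Ω}
    {α : Ω → ℝ} (hα : ∀ x, f x = T (α x) x) :
    ∃ (f₁ : Ω ≃ₜ Ω) (α₁ : Ω → ℝ) (C₁ C₂ : Set Ω) (R η : ℝ), (∀ x, f₁ x = T (α₁ x) x) ∧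
      ((∀ x, Tendsto f (V x) (V (f x))) → ∀ x, Tendsto f₁ (V x) (V (f₁ x))) ∧
      IsCrossSection T V C₁ R ∧ IsCrossSection T V C₂ R ∧ 0 < η ∧
      (∀ y ∈ C₁, ∀ s, |s| < η → f₁ (T s y) = T s y) ∧
      ∀ y ∈ C₂, ∀ s, |s| < η → f₁ (T s y) = f (T s y) := by
  have hc := hT.continuous_displacement f.continuous hα
  have hm := hT.strictMono_displacement f.continuous f.injective hα
  obtain ⟨A, hA, hb⟩ := IsTransverseTo.exists_bound hc
  -- `L > A` keeps the slope of `A * θ` along the orbits below `1`.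
  set L : ℝ := 2 * A + 1 with hL
  have hL0 : 0 < L := by linarith
  obtain ⟨C, -, hC⟩ := hT.exists_isCrossSection (R := 10 * L) (by positivity)
  obtain ⟨θ, hθc, hθ0, hθV, hθL, hθ1, hθ2⟩ := hC.exists_bump hT hL0
  -- Clamping `α` to `[-A θ, A θ]` keeps it where `θ = 1`, because `|α| ≤ A`, and kills it where `θ
  -- = 0`.
  set α₁ : Ω → ℝ := fun x => max (-(A * θ x)) (min (α x) (A * θ x)) with hα₁
  have hc₁ : Continuous α₁ := by fun_prop
  have hlip : ∀ x s s', s < s' → A * |θ (T s' x) - θ (T s x)| < s' - s := by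
    intro x s s' hs
    have h1 := hθL (s' - s) (T s x)
    rw [← T.map_add, sub_add_cancel, abs_of_pos (sub_pos.2 hs)] at h1
    have h2 : A * (L⁻¹ * (s' - s)) < s' - s := by
      rw [← mul_assoc, ← div_eq_mul_inv]
      have : A / L < 1 := by rw [div_lt_one hL0]; linarith
      nlinarith [sub_pos.2 hs]
    exact (mul_le_mul_of_nonneg_left h1 hA.le).trans_lt h2
  have hm₁ : ∀ x, StrictMono fun s => s + α₁ (T s x) := by
    intro x s s' hs
    have h1 := hm x hs
    have h2 := hlip x s s' hs
    rw [show A * |θ (T s' x) - θ (T s x)| = |A * (θ (T s' x) - θ (T s x))| by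
      rw [abs_mul, abs_of_pos hA], abs_lt, mul_sub] at h2
    simp only [hα₁] at h1 ⊢
    -- `s + α₁` is the clamp of `s + α` between `s - A θ` and `s + A θ`, all three increasing.
    rw [← max_add_add_left, ← max_add_add_left, ← min_add_add_left, ← min_add_add_left]
    refine max_lt_max (by linarith) (min_lt_min h1 (by linarith))
  obtain ⟨f₁, hf₁⟩ := IsTransverseTo.exists_homeomorph hc₁ hm₁
  refine ⟨f₁, α₁, T (5 * L) '' C, C, 10 * L, L, hf₁, fun h x => ?_, hC.translate hT _, hC, hL0, ?_,
    fun y hy s hs => ?_⟩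
  · refine hT.tendsto_of_displacement hf₁ ?_
    filter_upwards [hT.displacement_of_tendsto hc hα (h x), hθV x] with y h1 h2
    simp only [hα₁, h1, h2]
  · rintro _ ⟨y, hy, rfl⟩ s hs
    rw [hf₁]
    have h0 : θ (T s (T (5 * L) y)) = 0 := by
      -- A hit would be a return of `y` at a time in `(2L, 8L)`, which the gap `10 * L` excludes.
      refine hθ2 _ fun s' hs' h => ?_
      rw [← T.map_add, ← T.map_add] at h
      have a := abs_lt.1 hs
      have b := abs_lt.1 hs'
      have := hC.gap y hy _ (abs_lt.2 ⟨by linarith, by linarith⟩) h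
      linarith
    have h1 : α₁ (T s (T (5 * L) y)) = 0 := by
      simp only [hα₁, h0, mul_zero, neg_zero]
      exact max_eq_left (min_le_right _ _)
    rw [h1, T.map_zero_apply]
  · have h1 := hθ1 y hy s hs.le
    have h2 := abs_le.1 (hb (T s y))
    rw [hf₁, hα]
    congr 1
    simp only [hα₁, h1, mul_one]
    rw [min_eq_left h2.2, max_eq_right h2.1]

end CrossSection

/-! ### The suspension structure given by a cross-section -/

section Suspension

variable {Ω : Type u} [MetricSpace Ω] {T : Flow ℝ Ω} {V : Ω → Filter Ω} {C : Set Ω} {R : ℝ}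

/-- The first time, from `R` on, at which the orbit of `x` hits `C`. -/
noncomputable def returnTime (T : Flow ℝ Ω) (C : Set Ω) (R : ℝ) (x : Ω) : ℝ :=
  sInf {s | R ≤ s ∧ T s x ∈ C}

/-- The point of the orbit of `c` whose time is the fraction `u` of the return time of `c`. -/
noncomputable def suspend (T : Flow ℝ Ω) (C : Set Ω) (R : ℝ) (c : Ω) (u : ℝ) : Ω :=
  T (returnTime T C R c * u) c

theorem suspend_zero (c : Ω) : suspend T C R c 0 = c := by
  rw [suspend, mul_zero, T.map_zero_apply]

theorem returnTime_le {x : Ω} {s : ℝ} (h : R ≤ s) (h' : T s x ∈ C) : returnTime T C R x ≤ s :=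
  csInf_le ⟨R, fun _ hs => hs.1⟩ ⟨h, h'⟩

namespace IsCrossSection

theorem exists_returnTime_bound (hC : IsCrossSection T V C R) :
    ∃ M, ∀ x, ∃ s ≤ M, R ≤ s ∧ T s x ∈ C := by
  obtain ⟨M, hM⟩ := hC.hits
  refine ⟨M + R, fun x => ?_⟩
  obtain ⟨s, hs, h⟩ := hM (T R x)
  exact ⟨s + R, by linarith [hs.2], by linarith [hs.1], by rwa [T.map_add]⟩

theorem returnTime_mem (hC : IsCrossSection T V C R) (x : Ω) :
    R ≤ returnTime T C R x ∧ T (returnTime T C R x) x ∈ C := by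
  obtain ⟨M, hM⟩ := hC.exists_returnTime_bound
  obtain ⟨s, -, hs⟩ := hM x
  have hcl : IsClosed {s | R ≤ s ∧ T s x ∈ C} :=
    isClosed_Ici.inter (hC.isCompact.isClosed.preimage (T.continuous_apply_left x))
  exact hcl.csInf_mem ⟨s, hs⟩ ⟨R, fun _ hs => hs.1⟩

theorem returnTime_pos (hC : IsCrossSection T V C R) (x : Ω) : 0 < returnTime T C R x :=
  hC.pos.trans_le (hC.returnTime_mem x).1

theorem suspend_one_mem (hC : IsCrossSection T V C R) (c : Ω) : suspend T C R c 1 ∈ C := by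
  rw [suspend, mul_one]; exact (hC.returnTime_mem c).2

theorem notMem_of_lt_returnTime (hC : IsCrossSection T V C R) {c : Ω} (hc : c ∈ C) {s : ℝ}
    (h0 : 0 < s) (h1 : s < returnTime T C R c) : T s c ∉ C := fun h => by
  rcases lt_or_ge s R with h2 | h2
  · exact h0.ne' (hC.gap c hc s (by rwa [abs_of_pos h0]) h)
  · exact h1.not_ge (returnTime_le h2 h)

/-- Return times are at most `M`, so they are read off from the hits in a fixed window, which are
transversally locally constant. -/
theorem eventually_returnTime_eq (hT : IsTransverseTo T V) (hC : IsCrossSection T V C R) (x : Ω) :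
    ∀ᶠ y in V x, returnTime T C R y = returnTime T C R x := by
  obtain ⟨M, hM⟩ := hC.exists_returnTime_bound
  have hle : ∀ y, returnTime T C R y ≤ M := fun y => by
    obtain ⟨s, hs, h, h'⟩ := hM y
    exact (returnTime_le h h').trans hs
  filter_upwards [hC.eventually_mem_iff hT x M] with y hy
  have hmem : ∀ z, returnTime T C R z ∈ Icc (-M) M := fun z =>
    ⟨by linarith [hC.returnTime_pos z, hle z], hle z⟩
  exact le_antisymm
    (returnTime_le (hC.returnTime_mem x).1 ((hy _ (hmem x)).2 (hC.returnTime_mem x).2))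
    (returnTime_le (hC.returnTime_mem y).1 ((hy _ (hmem y)).1 (hC.returnTime_mem y).2))

/-- This turns transverse statements at points of `C` into statements about the topology of the
space `C`. -/
theorem eq_map_val (hC : IsCrossSection T V C R) (c : C) : V c = map Subtype.val (𝓝 c) := by
  rw [← hC.nhds_eq c c.2, nhdsWithin_eq_map_subtype_coe c.2]

theorem eventually_returnTime_val_eq (hT : IsTransverseTo T V) (hC : IsCrossSection T V C R)
    (c : C) : ∀ᶠ c' : C in 𝓝 c, returnTime T C R c' = returnTime T C R c := by
  have h := hC.eventually_returnTime_eq hT c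
  rwa [hC.eq_map_val, eventually_map] at h

theorem continuous_returnTime (hT : IsTransverseTo T V) (hC : IsCrossSection T V C R) :
    Continuous fun c : C => returnTime T C R c :=
  ((IsLocallyConstant.iff_eventually_eq _).2
    (hC.eventually_returnTime_val_eq hT)).continuous

theorem continuous_suspend (hT : IsTransverseTo T V) (hC : IsCrossSection T V C R) :
    Continuous fun p : C × ℝ => suspend T C R p.1 p.2 :=
  T.continuous (((hC.continuous_returnTime hT).comp continuous_fst).mul continuous_snd)
    (continuous_subtype_val.comp continuous_fst)

/-- Follow the orbit backwards to the most recent hit of `C`, at elapsed time `p`. The return time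
there exceeds `p`, for otherwise there would be a more recent hit. -/
theorem exists_suspend_eq (hC : IsCrossSection T V C R) (x : Ω) :
    ∃ (c : C) (u : ℝ), u ∈ Ico (0 : ℝ) 1 ∧ suspend T C R c u = x := by
  set P : Set ℝ := {s | 0 ≤ s ∧ T (-s) x ∈ C}
  have hcl : IsClosed P := isClosed_Ici.inter
    (hC.isCompact.isClosed.preimage ((T.continuous_apply_left x).comp continuous_neg))
  have hbd : BddBelow P := ⟨0, fun _ hs => hs.1⟩
  have hne : P.Nonempty := by
    obtain ⟨M, hM⟩ := hC.hits
    obtain ⟨s, hs, h⟩ := hM (T (-M) x)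
    refine ⟨M - s, by linarith [hs.2], ?_⟩
    rwa [← T.map_add, show s + -M = -(M - s) by ring] at h
  obtain ⟨hp0, hp⟩ := hcl.csInf_mem hne hbd
  set p := sInf P
  have hr := hC.returnTime_pos (T (-p) x)
  refine ⟨⟨T (-p) x, hp⟩, p / returnTime T C R (T (-p) x), ⟨by positivity, ?_⟩, ?_⟩
  · rw [div_lt_one hr]
    by_contra! h
    have h1 : p - returnTime T C R (T (-p) x) ∈ P := by
      refine ⟨by linarith, ?_⟩
      have := (hC.returnTime_mem (T (-p) x)).2
      rwa [← T.map_add, show returnTime T C R (T (-p) x) + -p =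
        -(p - returnTime T C R (T (-p) x)) by ring] at this
    linarith [csInf_le hbd h1]
  · simp only [suspend]
    rw [mul_div_cancel₀ _ hr.ne', T.apply_neg_self]

/-- The point `c` lies on the orbit of `c'` at a nonnegative time shorter than the return time of
`c'`, so that time is `0`. -/
theorem suspend_injective_aux (hC : IsCrossSection T V C R) {c c' : C}
    {u u' : ℝ} (hu : u ∈ Ico (0 : ℝ) 1) (hu' : u' ∈ Ico (0 : ℝ) 1)
    (h : suspend T C R c u = suspend T C R c' u')
    (hle : returnTime T C R c * u ≤ returnTime T C R c' * u') : c = c' ∧ u = u' := by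
  have hr := hC.returnTime_pos c
  have hr' := hC.returnTime_pos c'
  have h1 : (c : Ω) = T (returnTime T C R c' * u' - returnTime T C R c * u) c' := by
    rw [sub_eq_neg_add, T.map_add]
    simp only [suspend] at h
    rw [← h, T.neg_apply_self]
  have h2 : returnTime T C R c' * u' - returnTime T C R c * u = 0 := by
    by_contra hne
    refine hC.notMem_of_lt_returnTime c'.2 (lt_of_le_of_ne (sub_nonneg.2 hle) (Ne.symm hne)) ?_
      (h1 ▸ c.2)
    have := mul_nonneg hr.le hu.1
    nlinarith [hu'.2]
  rw [h2, T.map_zero_apply] at h1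
  obtain rfl : c = c' := Subtype.ext h1
  exact ⟨rfl, (mul_left_cancel₀ hr.ne' (by linarith))⟩

theorem suspend_injective (hC : IsCrossSection T V C R) {c c' : C}
    {u u' : ℝ} (hu : u ∈ Ico (0 : ℝ) 1) (hu' : u' ∈ Ico (0 : ℝ) 1)
    (h : suspend T C R c u = suspend T C R c' u') : c = c' ∧ u = u' := by
  rcases le_total (returnTime T C R c * u) (returnTime T C R c' * u') with hle | hle
  · exact hC.suspend_injective_aux hu hu' h hle
  · exact (hC.suspend_injective_aux hu' hu h.symm hle).imp Eq.symm Eq.symm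

/-- A family of order automorphisms supported in `[0, 1]` acts on the suspension. -/
theorem exists_suspension_map (hC : IsCrossSection T V C R)
    {G : C → ℝ ≃o ℝ} (hG : ∀ c u, u ≤ 0 ∨ 1 ≤ u → G c u = u) :
    ∃ f : Ω → Ω, ∀ (c : C), ∀ u ∈ Icc (0 : ℝ) 1,
      f (suspend T C R c u) = suspend T C R c (G c u) := by
  choose b v hv hb using hC.exists_suspend_eq
  have key : ∀ (c : C), ∀ u ∈ Ico (0 : ℝ) 1,
      suspend T C R (b (suspend T C R c u)) (G (b (suspend T C R c u)) (v (suspend T C R c u))) =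
        suspend T C R c (G c u) := fun c u hu => by
    obtain ⟨h1, h2⟩ := hC.suspend_injective (hv _) hu (hb (suspend T C R c u))
    rw [h1, h2]
  refine ⟨fun x => suspend T C R (b x) (G (b x) (v x)), fun c u hu => ?_⟩
  rcases hu.2.lt_or_eq with h | rfl
  · exact key c u ⟨hu.1, h⟩
  -- The end `u = 1` of a cell is the start `u = 0` of the next; the formulas agree because both
  -- ends are fixed.
  · have h1 := key ⟨_, hC.suspend_one_mem c⟩ 0 ⟨le_rfl, one_pos⟩
    rw [hG _ 0 (Or.inl le_rfl)] at h1
    simp only [suspend_zero] at h1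
    simp only
    rw [h1, hG c 1 (Or.inr le_rfl)]

theorem orderIso_mem_Icc {X : Type*} {G : X → ℝ ≃o ℝ}
    (hG : ∀ c u, u ≤ 0 ∨ 1 ≤ u → G c u = u) (c : X) {u : ℝ} (hu : u ∈ Icc (0 : ℝ) 1) : G c u ∈ Icc (0 : ℝ) 1 := by
  constructor
  · rw [← hG c 0 (Or.inl le_rfl)]; exact (G c).monotone hu.1
  · rw [← hG c 1 (Or.inr le_rfl)]; exact (G c).monotone hu.2

/-- `C × [0, 1] → Ω` is a quotient map by compactness, so continuity is checked upstairs, where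
pointwise continuity in `c` suffices by `continuous_uncurry_orderIso`. The inverse family gives the
inverse map. -/
theorem exists_suspension_homeomorph [CompactSpace Ω] (hT : IsTransverseTo T V)
    (hC : IsCrossSection T V C R) {G : C → ℝ ≃o ℝ} (hG : ∀ c u, u ≤ 0 ∨ 1 ≤ u → G c u = u)
    (hGc : ∀ u, Continuous fun c => G c u) :
    ∃ f : Ω ≃ₜ Ω, ∀ (c : C), ∀ u ∈ Icc (0 : ℝ) 1,
      f (suspend T C R c u) = suspend T C R c (G c u) := by
  have hG' : ∀ c u, u ≤ 0 ∨ 1 ≤ u → (G c).symm u = u := fun c u hu => by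
    rw [OrderIso.symm_apply_eq, hG c u hu]
  obtain ⟨f, hf⟩ := hC.exists_suspension_map hG
  obtain ⟨f', hf'⟩ := hC.exists_suspension_map hG'
  have : CompactSpace C := isCompact_iff_compactSpace.1 hC.isCompact
  have hq : IsQuotientMap fun p : C × unitInterval => suspend T C R p.1 p.2 := by
    have hc : Continuous fun p : C × unitInterval => suspend T C R p.1 p.2 :=
      (hC.continuous_suspend hT).comp
        (continuous_fst.prodMk (continuous_subtype_val.comp continuous_snd))
    refine hc.isClosedMap.isQuotientMap hc fun x => ?_
    obtain ⟨c, u, hu, h⟩ := hC.exists_suspend_eq x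
    exact ⟨(c, ⟨u, hu.1, hu.2.le⟩), h⟩
  have hcont : Continuous f := by
    refine hq.continuous_iff.2 ?_
    have h1 : (f ∘ fun p : C × unitInterval => suspend T C R p.1 p.2) =
        fun p : C × unitInterval => suspend T C R p.1 (G p.1 p.2) :=
      funext fun p => hf p.1 p.2 p.2.2
    rw [h1]
    have h2 : Continuous fun p : C × unitInterval => G p.1 (p.2 : ℝ) :=
      (continuous_uncurry_orderIso hGc).comp
        (continuous_fst.prodMk (continuous_subtype_val.comp continuous_snd))
    exact (hC.continuous_suspend hT).comp (continuous_fst.prodMk h2)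
  have hinv : Function.LeftInverse f' f := fun x => by
    obtain ⟨c, u, hu, rfl⟩ := hC.exists_suspend_eq x
    have hu' : u ∈ Icc (0 : ℝ) 1 := ⟨hu.1, hu.2.le⟩
    rw [hf c u hu', hf' c _ (orderIso_mem_Icc hG c hu'), OrderIso.symm_apply_apply]
  have hinv' : Function.RightInverse f' f := fun x => by
    obtain ⟨c, u, hu, rfl⟩ := hC.exists_suspend_eq x
    have hu' : u ∈ Icc (0 : ℝ) 1 := ⟨hu.1, hu.2.le⟩
    rw [hf' c u hu', hf c _ (orderIso_mem_Icc hG' c hu'), OrderIso.apply_symm_apply]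
  exact ⟨hcont.homeoOfEquivCompactToT2 (f := ⟨f, f', hinv, hinv'⟩), hf⟩

theorem exists_time_of_suspension (hC : IsCrossSection T V C R) {f : Ω → Ω} {G : C → ℝ ≃o ℝ}
    (hf : ∀ (c : C), ∀ u ∈ Icc (0 : ℝ) 1, f (suspend T C R c u) = suspend T C R c (G c u)) (x : Ω) :
    ∃ s, f x = T s x := by
  obtain ⟨c, u, hu, rfl⟩ := hC.exists_suspend_eq x
  refine ⟨returnTime T C R c * G c u - returnTime T C R c * u, ?_⟩
  rw [hf c u ⟨hu.1, hu.2.le⟩, suspend, suspend, ← T.map_add, sub_add_cancel]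

/-- The return time and `G · u` are locally constant on `C`, so on the transversal through `suspend
T C R c u` the map is translation by a fixed time. -/
theorem tendsto_of_suspension (hT : IsTransverseTo T V) (hC : IsCrossSection T V C R) {f : Ω → Ω}
    {G : C → ℝ ≃o ℝ}
    (hf : ∀ (c : C), ∀ u ∈ Icc (0 : ℝ) 1, f (suspend T C R c u) = suspend T C R c (G c u))
    (hG : ∀ (u : ℝ) (c : C), ∀ᶠ c' in 𝓝 c, G c' u = G c u) (x : Ω) :
    Tendsto f (V x) (V (f x)) := by
  obtain ⟨c, u, hu, rfl⟩ := hC.exists_suspend_eq x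
  have hu' : u ∈ Icc (0 : ℝ) 1 := ⟨hu.1, hu.2.le⟩
  rw [hf c u hu', suspend, suspend]
  refine Tendsto.mono_left (tendsto_map'_iff.2 ?_) (hT.le_map _ _)
  refine (hT.tendsto (returnTime T C R c * G c u) c).congr' ?_
  rw [hC.eq_map_val c]
  refine eventually_map.2 ?_
  filter_upwards [hG u c, hC.eventually_returnTime_val_eq hT c] with c' h1 h2
  have h3 := hf c' u hu'
  rw [suspend, suspend, h1, h2] at h3
  exact h3.symm

/-- An orbit-preserving homeomorphism which is the identity near a cross-section acts on the
suspension by a family of order automorphisms with uniformly compact supports in `(0, 1)`. -/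
theorem exists_suspension_family [CompactSpace Ω] (hT : IsTransverseTo T V)
    (hC : IsCrossSection T V C R) {g : Ω ≃ₜ Ω} {α : Ω → ℝ} (hα : ∀ x, g x = T (α x) x) {η : ℝ}
    (hη : 0 < η) (hg : ∀ y ∈ C, ∀ s, |s| < η → g (T s y) = T s y) :
    ∃ δ > 0, ∃ H : C → ℝ ≃o ℝ, (∀ c u, u ≤ δ ∨ 1 - δ ≤ u → H c u = u) ∧
      (∀ (c : C), ∀ u ∈ Icc (0 : ℝ) 1, g (suspend T C R c u) = suspend T C R c (H c u)) ∧
      (∀ u, Continuous fun c => H c u) ∧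
      ((∀ x, Tendsto g (V x) (V (g x))) →
        ∀ (u : ℝ) (c : C), ∀ᶠ c' in 𝓝 c, H c' u = H c u) := by
  have hc := hT.continuous_displacement g.continuous hα
  have hm := hT.strictMono_displacement g.continuous g.injective hα
  have hα0 : ∀ y ∈ C, ∀ s, |s| < η → α (T s y) = 0 := fun y hy s hs => by
    have h := hg y hy s hs
    rw [hα] at h
    exact hT.free _ _ h
  obtain ⟨A, hA, hb⟩ := IsTransverseTo.exists_bound hc
  obtain ⟨M, hM⟩ := hC.exists_returnTime_bound
  have hle : ∀ y, returnTime T C R y ≤ M := fun y => by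
    obtain ⟨s, hs, h, h'⟩ := hM y
    exact (returnTime_le h h').trans hs
  -- Clamping `u` to `[0, 1]` extends the rescaled displacement `β` constantly to all of `ℝ`.
  let k : ℝ → ℝ := fun u => max 0 (min 1 u)
  have hk : Continuous k := by fun_prop
  have hk01 : ∀ u ∈ Icc (0 : ℝ) 1, k u = u := fun u hu => by
    simp only [k]; rw [min_eq_right hu.2, max_eq_right hu.1]
  let β : C → ℝ → ℝ := fun c u => α (suspend T C R c (k u)) / returnTime T C R c
  have hβ2 : Continuous fun p : C × ℝ => β p.1 p.2 :=
    (hc.comp ((hC.continuous_suspend hT).comp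
      (continuous_fst.prodMk (hk.comp continuous_snd)))).div₀
      ((hC.continuous_returnTime hT).comp continuous_fst)
      fun p => (hC.returnTime_pos p.1).ne'
  have hcu : ∀ c, Continuous fun u => u + β c u := fun c =>
    continuous_id.add (hβ2.comp (continuous_const.prodMk continuous_id))
  have hmono : ∀ c, StrictMono fun u => u + β c u := by
    intro c u v huv
    have hr := hC.returnTime_pos (c : Ω)
    -- `u + β c u` is the sum of `u - k u`, which is monotone, and of `k u + β c u`, which increases
    -- strictly wherever `k` does.
    have h1 : u - k u ≤ v - k v := by
      simp only [k]
      rcases max_cases 0 (min 1 u) with a | a <;> rcases max_cases 0 (min 1 v) with b | b <;>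
        rcases min_cases 1 u with c | c <;> rcases min_cases 1 v with d | d <;> linarith
    have h2 : k u ≤ k v := max_le_max le_rfl (min_le_min le_rfl huv.le)
    simp only [β]
    rcases h2.eq_or_lt with h | h
    · rw [h]; linarith
    · have h3 := hm (c : Ω) (mul_lt_mul_of_pos_left h hr)
      simp only at h3
      have h4 : k u + α (suspend T C R c (k u)) / returnTime T C R c <
          k v + α (suspend T C R c (k v)) / returnTime T C R c := by
        rw [← mul_lt_mul_iff_right₀ hr, mul_add, mul_add, mul_div_cancel₀ _ hr.ne',
          mul_div_cancel₀ _ hr.ne']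
        exact h3
      linarith
  have hβb : ∀ c u, |β c u| ≤ A / R := fun c u => by
    simp only [β]
    rw [abs_div, abs_of_pos (hC.returnTime_pos _)]
    exact div_le_div₀ hA.le (hb _) hC.pos (hC.returnTime_mem _).1
  have hsurj : ∀ c, Function.Surjective fun u => u + β c u := fun c =>
    (hcu c).surjective
      (tendsto_atTop_add_right_of_le _ (-(A / R)) tendsto_id fun u => (abs_le.1 (hβb c u)).1)
      (tendsto_atBot_add_right_of_ge _ (A / R) tendsto_id fun u => (abs_le.1 (hβb c u)).2)
  have hM0 : ∀ c : C, 0 < M := fun c => (hC.returnTime_pos (c : Ω)).trans_le (hle c)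
  -- Return times are at most `M`, so a fraction `δ` of one lasts at most `η / 2`; the `max` keeps
  -- `δ` positive whatever `M` is.
  refine ⟨η / (2 * max M 1), by positivity, fun c => (hmono c).orderIsoOfSurjective _ (hsurj c),
    fun c u hu => ?_, fun c u hu => ?_, fun u => ?_, fun hV u c => ?_⟩
  · change u + β c u = u
    have hr := hC.returnTime_pos (c : Ω)
    have hsmall : ∀ w, 0 ≤ w → w ≤ η / (2 * max M 1) → returnTime T C R c * w < η :=
      fun w hw0 hw => by
        have h1 : returnTime T C R c ≤ max M 1 := (hle c).trans (le_max_left _ _)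
        have h2 : returnTime T C R c * w ≤ max M 1 * (η / (2 * max M 1)) :=
          mul_le_mul h1 hw hw0 (by positivity)
        have h3 : max M 1 * (η / (2 * max M 1)) = η / 2 := by field_simp
        linarith
    have hzero : α (suspend T C R c (k u)) = 0 := by
      rcases hu with hu | hu
      · have h0 : 0 ≤ k u := le_max_left _ _
        have h1 : k u ≤ η / (2 * max M 1) :=
          max_le (by positivity) ((min_le_right _ _).trans hu)
        refine hα0 c c.2 _ ?_
        rw [abs_of_nonneg (by positivity)]
        exact hsmall _ h0 h1
      · have h0 : 0 ≤ 1 - k u :=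
          sub_nonneg.2 (max_le zero_le_one (min_le_left _ _))
        have h1 : 1 - k u ≤ η / (2 * max M 1) := by
          have : 1 - η / (2 * max M 1) ≤ k u :=
            (le_min (by linarith [show 0 < η / (2 * max M 1) by positivity]) hu).trans
              (le_max_right _ _)
          linarith
        -- Near `u = 1` the relevant point of `C` is the next hit, approached at a small negative
        -- time.
        have h2 : suspend T C R c (k u) =
            T (-(returnTime T C R c * (1 - k u))) (suspend T C R c 1) := by
          rw [suspend, suspend, ← T.map_add]
          congr 1
          ring
        rw [h2]
        refine hα0 _ (hC.suspend_one_mem c) _ ?_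
        rw [abs_neg, abs_of_nonneg (by positivity)]
        exact hsmall _ h0 h1
    simp only [β]
    rw [hzero, zero_div, add_zero]
  · change g _ = suspend T C R c (u + β c u)
    simp only [β]
    rw [hα, hk01 u hu, suspend, suspend, ← T.map_add, mul_add,
      mul_div_cancel₀ _ (hC.returnTime_pos _).ne', add_comm]
  · change Continuous fun c => u + β c u
    exact continuous_const.add (hβ2.comp (continuous_id.prodMk continuous_const))
  · change ∀ᶠ c' in 𝓝 c, u + β c' u = u + β c u
    have h1 := (hT.tendsto (returnTime T C R c * k u) c).eventually
      (hT.displacement_of_tendsto hc hα (hV _))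
    rw [hC.eq_map_val c, eventually_map] at h1
    filter_upwards [h1, hC.eventually_returnTime_val_eq hT c] with c' h1 h2
    simp only [β]
    rw [suspend, h2, h1, suspend]

/-- An orbit-preserving homeomorphism which is the identity near a cross-section is a commutator. -/
theorem exists_commutator [CompactSpace Ω] (hT : IsTransverseTo T V)
    (hC : IsCrossSection T V C R) {g : Ω ≃ₜ Ω} {α : Ω → ℝ} (hα : ∀ x, g x = T (α x) x) {η : ℝ}
    (hη : 0 < η) (hg : ∀ y ∈ C, ∀ s, |s| < η → g (T s y) = T s y) :
    ∃ a b : Ω ≃ₜ Ω, g = ⁅a, b⁆ ∧ (∀ x, ∃ s, a x = T s x) ∧ (∀ x, ∃ s, b x = T s x) ∧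
      ((∀ x, Tendsto g (V x) (V (g x))) →
        (∀ x, Tendsto a (V x) (V (a x))) ∧ ∀ x, Tendsto b (V x) (V (b x))) := by
  obtain ⟨δ, hδ, H, hHδ, hgH, hHc, hHV⟩ := hC.exists_suspension_family hT hα hη hg
  obtain ⟨h, G, hh, hG, hGH, hGE⟩ := exists_commutator_family hδ H hHδ
  -- Through `G c u = E (H c w)` the continuity in `c` is inherited from `H`, and so is local
  -- constancy below.
  have hGc : ∀ u, Continuous fun c => G c u := fun u => by
    obtain ⟨w, E, hE, hw, hGu⟩ := hGE u
    simp only [hGu]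
    exact hE.comp_continuous (hHc w) hw
  obtain ⟨a, ha⟩ := hC.exists_suspension_homeomorph hT hG hGc
  obtain ⟨b, hb⟩ := hC.exists_suspension_homeomorph hT (G := fun _ => h) (fun _ => hh)
    fun u => continuous_const
  refine ⟨a, b, ?_, hC.exists_time_of_suspension ha, hC.exists_time_of_suspension hb,
    fun hV => ⟨hC.tendsto_of_suspension hT ha fun u c => ?_, hC.tendsto_of_suspension hT hb
      fun u c => Eventually.of_forall fun _ => rfl⟩⟩
  · rw [commutatorElement_def, eq_mul_inv_iff_mul_eq, eq_mul_inv_iff_mul_eq]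
    ext x
    obtain ⟨c, u, hu, rfl⟩ := hC.exists_suspend_eq x
    have hu' : u ∈ Icc (0 : ℝ) 1 := ⟨hu.1, hu.2.le⟩
    have h1 := orderIso_mem_Icc hG c hu'
    have h2 := orderIso_mem_Icc (G := fun _ : C => h) (fun _ => hh) c hu'
    have h3 := orderIso_mem_Icc (G := fun _ : C => h) (fun _ => hh) c h1
    change g (b (a _)) = a (b _)
    rw [ha c u hu', hb c _ h1, hgH c _ h3, hb c u hu', ha c _ h2]
    have h4 := hGH c
    rw [commutatorElement_def, eq_mul_inv_iff_mul_eq, eq_mul_inv_iff_mul_eq] at h4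
    exact congrArg (suspend T C R c) (DFunLike.congr_fun h4 u)
  · obtain ⟨w, E, -, -, hGu⟩ := hGE u
    filter_upwards [hHV hV w c] with c' hc'
    rw [hGu, hGu, hc']

end IsCrossSection

/-- Every orbit-preserving homeomorphism is a product of two commutators of orbit-preserving
homeomorphisms, which preserve the transverse structure if the given one does. -/
theorem IsTransverseTo.exists_two_commutators [CompactSpace Ω] [Nonempty Ω]
    (hT : IsTransverseTo T V) {f : Ω ≃ₜ Ω} (hf : ∀ x, ∃ s, f x = T s x) :
    ∃ a b c d : Ω ≃ₜ Ω, f = ⁅a, b⁆ * ⁅c, d⁆ ∧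
      (∀ h ∈ ({a, b, c, d} : Set (Ω ≃ₜ Ω)), ∀ x, ∃ s, h x = T s x) ∧
      ((∀ x, Tendsto f (V x) (V (f x))) →
        ∀ h ∈ ({a, b, c, d} : Set (Ω ≃ₜ Ω)), ∀ x, Tendsto h (V x) (V (h x))) := by
  choose α hα using hf
  obtain ⟨f₁, α₁, C₁, C₂, R, η, hα₁, hV₁, hC₁, hC₂, hη, h1, h2⟩ := hT.exists_fragment hα
  have hinv : ∀ y, f₁.symm y = T (-α₁ (f₁.symm y)) y := fun y => by
    have h := hα₁ (f₁.symm y)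
    rw [f₁.apply_symm_apply] at h
    exact (T.neg_apply_self _ _).symm.trans (congrArg (T _) h.symm)
  have hα₂ : ∀ x, (f₁⁻¹ * f) x = T (-α₁ (f₁.symm (f x)) + α x) x := fun x => by
    change f₁.symm (f x) = _
    rw [T.map_add, ← hα, ← hinv]
  obtain ⟨a, b, e₁, ha, hb, hab⟩ := hC₁.exists_commutator hT hα₁ hη h1
  obtain ⟨c, d, e₂, hc, hd, hcd⟩ := hC₂.exists_commutator hT hα₂ hη fun y hy s hs => by
    change f₁.symm (f _) = _
    rw [← h2 y hy s hs, f₁.symm_apply_apply]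
  refine ⟨a, b, c, d, by rw [← e₁, ← e₂, mul_inv_cancel_left], ?_, fun hV => ?_⟩
  · rintro h (rfl | rfl | rfl | rfl) <;> assumption
  -- On the transversal through `f₁.symm y` the map `f₁` is a fixed translation, so its inverse is
  -- the opposite one on the transversal through `y`.
  · have hVinv : ∀ y, Tendsto f₁.symm (V y) (V (f₁.symm y)) := fun y => by
      refine hT.tendsto_of_displacement hinv ?_
      have hc₁ := hT.continuous_displacement f₁.continuous hα₁
      have h3 := hT.displacement_of_tendsto hc₁ hα₁ (hV₁ hV (f₁.symm y))
      have h4 : ∀ᶠ z in V y, T (-α₁ (f₁.symm y)) z ∈ {w | α₁ w = α₁ (f₁.symm y)} := by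
        have h5 := hT.tendsto (-α₁ (f₁.symm y)) y
        rw [← hinv y] at h5
        exact h5.eventually h3
      filter_upwards [h4] with z hz
      have h6 : f₁ (T (-α₁ (f₁.symm y)) z) = z := by
        rw [hα₁, hz, T.apply_neg_self]
      rw [← h6, f₁.symm_apply_apply, hz]
    have hV₂ : ∀ x, Tendsto (f₁⁻¹ * f : Ω ≃ₜ Ω) (V x) (V ((f₁⁻¹ * f : Ω ≃ₜ Ω) x)) := fun x =>
      (hVinv (f x)).comp (hV x)
    obtain ⟨h3, h4⟩ := hab (hV₁ hV)
    obtain ⟨h5, h6⟩ := hcd hV₂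
    rintro h (rfl | rfl | rfl | rfl) <;> assumption

end Suspension

/-! ### The flow of a lamination -/

namespace FlatChart

variable {Ω : Type u} [TopologicalSpace Ω] (h : FlatChart Ω)

theorem isOpen_source : IsOpen h.source := h.toHomeo.open_source

theorem tcoord_mem {y : Ω} (hy : y ∈ h.source) : h.tcoord y ∈ h.D := by
  have := h.toHomeo.map_source hy
  rw [h.target_eq] at this
  exact this.1

theorem mem_target {t : ℝ} (ht : t ∈ h.D) (c : h.C) : (t, c) ∈ h.toHomeo.target := by
  rw [h.target_eq]; exact ⟨ht, trivial⟩

theorem continuousOn_tcoord : ContinuousOn h.tcoord h.source :=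
  continuous_fst.comp_continuousOn h.toHomeo.continuousOn

theorem continuousOn_ccoord : ContinuousOn h.ccoord h.source :=
  continuous_snd.comp_continuousOn h.toHomeo.continuousOn

theorem ext_coord {y z : Ω} (hy : y ∈ h.source) (hz : z ∈ h.source) (ht : h.tcoord y = h.tcoord z)
    (hc : h.ccoord y = h.ccoord z) : y = z :=
  h.toHomeo.injOn hy hz (Prod.ext ht hc)

/-- The point of the box with given coordinates. -/
def point (t : ℝ) (c : h.C) : Ω := h.toHomeo.symm (t, c)

variable {h}

theorem point_mem {t : ℝ} (ht : t ∈ h.D) (c : h.C) : h.point t c ∈ h.source :=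
  h.toHomeo.map_target (h.mem_target ht c)

theorem tcoord_point {t : ℝ} (ht : t ∈ h.D) (c : h.C) : h.tcoord (h.point t c) = t := by
  rw [tcoord, point, h.toHomeo.right_inv (h.mem_target ht c)]

theorem ccoord_point {t : ℝ} (ht : t ∈ h.D) (c : h.C) : h.ccoord (h.point t c) = c := by
  rw [ccoord, point, h.toHomeo.right_inv (h.mem_target ht c)]

theorem point_coord {y : Ω} (hy : y ∈ h.source) : h.point (h.tcoord y) (h.ccoord y) = y :=
  h.toHomeo.left_inv hy

theorem continuousAt_point {X : Type*} [TopologicalSpace X] {t : X → ℝ} {c : X → h.C} {x : X}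
    (hx : t x ∈ h.D) (ht : ContinuousAt t x) (hc : ContinuousAt c x) :
    ContinuousAt (fun y => h.point (t y) (c y)) x :=
  ContinuousAt.comp (f := fun y => (t y, c y)) (h.toHomeo.continuousAt_symm (h.mem_target hx _))
    (ht.prodMk hc)

end FlatChart

namespace FlatLamination

variable {Ω : Type u} [TopologicalSpace Ω] (L : FlatLamination Ω)

theorem exists_chart (x : Ω) : ∃ h ∈ L.maximalAtlas, x ∈ h.source := by
  obtain ⟨h, hh, hx⟩ := L.cover x
  exact ⟨h, fun k hk => ⟨L.compat h hh k hk, L.compat k hk h hh⟩, hx⟩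

variable {L}

/-- Charts of the maximal atlas are by definition comparable only with the atlas; passing through an
atlas chart adds the two constants. -/
theorem eventually_tcoord_eq {h k : FlatChart Ω} (hh : h ∈ L.maximalAtlas)
    (hk : k ∈ L.maximalAtlas) {x : Ω} (hx : x ∈ h.source) (hx' : x ∈ k.source) :
    ∃ a, ∀ᶠ y in 𝓝 x, k.tcoord y = h.tcoord y + a := by
  obtain ⟨m, hm, hxm⟩ := L.cover x
  obtain ⟨V, hV, hxV, -, a, _, -, H⟩ := (hh m hm).1 x hx hxm
  obtain ⟨V', hV', hxV', -, a', _, -, H'⟩ := (hk m hm).2 x hxm hx'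
  refine ⟨a + a', ?_⟩
  filter_upwards [hV.mem_nhds hxV, hV'.mem_nhds hxV'] with y hy hy'
  rw [(H' y hy').1, (H y hy).1, add_assoc]

/-- The leafwise coordinates differ by a constant near `x`, so the verticals have the same germ
there. -/
theorem nhdsWithin_vertical_eq {h k : FlatChart Ω} (hh : h ∈ L.maximalAtlas)
    (hk : k ∈ L.maximalAtlas) {x : Ω} (hx : x ∈ h.source) (hx' : x ∈ k.source) :
    𝓝[h.vertical x] x = 𝓝[k.vertical x] x := by
  obtain ⟨a, ha⟩ := eventually_tcoord_eq hh hk hx hx'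
  rw [nhdsWithin_eq_iff_eventuallyEq]
  filter_upwards [ha, h.isOpen_source.mem_nhds hx, k.isOpen_source.mem_nhds hx'] with y hy h1 h2
  refine propext ⟨fun h3 => ⟨h2, ?_⟩, fun h3 => ⟨h1, ?_⟩⟩
  · rw [hy, ha.self_of_nhds, h3.2]
  · have h4 := h3.2
    rw [hy, ha.self_of_nhds] at h4
    exact add_right_cancel h4

/-! ### Unit-speed curves in the leaves -/

/-- The curve `φ` follows, near the parameter `s`, a slice of `h` at the signed speed `σ`. -/
def FollowsAt (h : FlatChart Ω) (σ : ℝ) (φ : ℝ → Ω) (s : ℝ) : Prop :=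
  ∀ᶠ s' in 𝓝 s, φ s' ∈ h.source ∧ h.ccoord (φ s') = h.ccoord (φ s) ∧
    h.tcoord (φ s') = h.tcoord (φ s) + σ * (s' - s)

namespace FollowsAt

variable {h k : FlatChart Ω} {σ τ : ℝ} {φ : ℝ → Ω} {s : ℝ}

theorem mem_source (H : FollowsAt h σ φ s) : φ s ∈ h.source := H.self_of_nhds.1

theorem continuousAt (H : FollowsAt h σ φ s) : ContinuousAt φ s := by
  have h1 : φ =ᶠ[𝓝 s] fun s' => h.point (h.tcoord (φ s) + σ * (s' - s)) (h.ccoord (φ s)) :=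
    H.mono fun s' hs' => by simp only; rw [← hs'.2.2, ← hs'.2.1, FlatChart.point_coord hs'.1]
  refine ContinuousAt.congr ?_ h1.symm
  exact FlatChart.continuousAt_point (by simpa using h.tcoord_mem H.mem_source) (by fun_prop)
    continuousAt_const

theorem eventually (H : FollowsAt h σ φ s) : ∀ᶠ s' in 𝓝 s, FollowsAt h σ φ s' := by
  filter_upwards [eventually_eventually_nhds.2 H, H] with s₁ h1 h2
  filter_upwards [h1] with s₂ h3
  refine ⟨h3.1, h3.2.1.trans h2.2.1.symm, ?_⟩
  rw [h3.2.2, h2.2.2]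
  ring

/-- Changing charts only adds a constant to the leafwise coordinate: this is the coherent
orientation of the leaves. -/
theorem speed_unique (hh : h ∈ L.maximalAtlas) (hk : k ∈ L.maximalAtlas) (H : FollowsAt h σ φ s)
    (H' : FollowsAt k τ φ s) : σ = τ := by
  obtain ⟨a, ha⟩ := eventually_tcoord_eq hh hk H.mem_source H'.mem_source
  have h1 : ∀ᶠ s' in 𝓝[≠] s, σ = τ := by
    filter_upwards [self_mem_nhdsWithin, nhdsWithin_le_nhds (H.continuousAt.eventually ha),
      nhdsWithin_le_nhds H, nhdsWithin_le_nhds H'] with s' hne e1 e2 e3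
    rw [e3.2.2, ha.self_of_nhds, e2.2.2] at e1
    have h2 : (σ - τ) * (s' - s) = 0 := by linarith
    rcases mul_eq_zero.1 h2 with h3 | h3
    · linarith
    · exact absurd (sub_eq_zero.1 h3) hne
  exact h1.exists.choose_spec

end FollowsAt

/-- An isometry between intervals of the line has slope `1` or `-1`. The reference parameter `s + ε
/ 2` fixes the sign, and distances to it and to `s` determine the value at `s'`. -/
theorem IsLeafIsometry.exists_followsAt {x : Ω} {φ : ℝ → Ω} (hφ : L.IsLeafIsometry x φ)
    {h : FlatChart Ω} (hh : h ∈ L.maximalAtlas) {s : ℝ} (hs : φ s ∈ h.source) :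
    FollowsAt h 1 φ s ∨ FollowsAt h (-1) φ s := by
  obtain ⟨ε, hε, H⟩ := hφ.isometric h hh s hs
  have hs0 : s ∈ Metric.ball s ε := Metric.mem_ball_self hε
  have ha : s + ε / 2 ∈ Metric.ball s ε := by
    rw [Metric.mem_ball, Real.dist_eq, add_sub_cancel_left, abs_of_pos] <;> linarith
  have key : ∀ s' ∈ Metric.ball s (ε / 2), s' ∈ Metric.ball s ε := fun s' hs' =>
    Metric.ball_subset_ball (by linarith) hs'
  have h1 := (H _ ha _ hs0).2.2
  rw [Real.dist_eq, Real.dist_eq, add_sub_cancel_left, abs_of_pos (by linarith : 0 < ε / 2)] at h1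
  rcases (abs_eq (by linarith)).1 h1 with h1 | h1
  · left
    filter_upwards [Metric.ball_mem_nhds s (half_pos hε)] with s' hs'
    obtain ⟨m, -, h2⟩ := H _ (key s' hs') _ hs0
    have h3 := (H _ (key s' hs') _ ha).2.2
    rw [Real.dist_eq, Real.dist_eq] at h2 h3
    rw [Metric.mem_ball, Real.dist_eq] at hs'
    refine ⟨m.1, m.2, ?_⟩
    have h4 := abs_lt.1 hs'
    rw [abs_of_neg (by linarith : s' - (s + ε / 2) < 0)] at h3
    rcases abs_cases (s' - s) with a | a <;>
      rcases abs_cases (h.tcoord (φ s') - h.tcoord (φ s)) with b | b <;>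
      rcases abs_cases (h.tcoord (φ s') - h.tcoord (φ (s + ε / 2))) with c | c <;> linarith
  · right
    filter_upwards [Metric.ball_mem_nhds s (half_pos hε)] with s' hs'
    obtain ⟨m, -, h2⟩ := H _ (key s' hs') _ hs0
    have h3 := (H _ (key s' hs') _ ha).2.2
    rw [Real.dist_eq, Real.dist_eq] at h2 h3
    rw [Metric.mem_ball, Real.dist_eq] at hs'
    refine ⟨m.1, m.2, ?_⟩
    have h4 := abs_lt.1 hs'
    rw [abs_of_neg (by linarith : s' - (s + ε / 2) < 0)] at h3
    rcases abs_cases (s' - s) with a | a <;>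
      rcases abs_cases (h.tcoord (φ s') - h.tcoord (φ s)) with b | b <;>
      rcases abs_cases (h.tcoord (φ s') - h.tcoord (φ (s + ε / 2))) with c | c <;> linarith

/-- A curve which follows the slices at speed `σ`. -/
def Follows (L : FlatLamination Ω) (σ : ℝ) (φ : ℝ → Ω) : Prop :=
  ∀ h ∈ L.maximalAtlas, ∀ s, φ s ∈ h.source → FollowsAt h σ φ s

theorem Follows.continuous {σ : ℝ} {φ : ℝ → Ω} (hφ : L.Follows σ φ) : Continuous φ := by
  rw [continuous_iff_continuousAt]
  intro s
  obtain ⟨h, hh, hs⟩ := L.exists_chart (φ s)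
  exact (hφ h hh s hs).continuousAt

theorem Follows.comp_affine {σ : ℝ} {φ : ℝ → Ω} (hφ : L.Follows σ φ) (a b : ℝ) :
    L.Follows (σ * a) fun s => φ (a * s + b) := by
  intro h hh s hs
  have h1 : Tendsto (fun s => a * s + b) (𝓝 s) (𝓝 (a * s + b)) := by
    have : Continuous fun s : ℝ => a * s + b := by fun_prop
    exact this.tendsto s
  filter_upwards [h1.eventually (hφ h hh _ hs)] with s' hs'
  refine ⟨hs'.1, hs'.2.1, ?_⟩
  rw [hs'.2.2]
  ring

/-- The sign does not depend on the chart and is locally constant in the parameter. -/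
theorem IsLeafIsometry.follows {x : Ω} {φ : ℝ → Ω} (hφ : L.IsLeafIsometry x φ) :
    L.Follows 1 φ ∨ L.Follows (-1) φ := by
  let p : ℝ → Prop := fun s => ∃ h ∈ L.maximalAtlas, FollowsAt h 1 φ s
  have hp : ∀ s, ¬ p s → ∀ h ∈ L.maximalAtlas, φ s ∈ h.source → FollowsAt h (-1) φ s :=
    fun s hs h hh hsh => (hφ.exists_followsAt hh hsh).resolve_left fun H => hs ⟨h, hh, H⟩
  have hloc : ∀ s, ∀ᶠ s' in 𝓝 s, (p s' ↔ p s) := by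
    intro s
    by_cases hs : p s
    · obtain ⟨h, hh, H⟩ := hs
      filter_upwards [H.eventually] with s' H'
      exact iff_of_true ⟨h, hh, H'⟩ ⟨h, hh, H⟩
    · obtain ⟨h, hh, hsh⟩ := L.exists_chart (φ s)
      filter_upwards [(hp s hs h hh hsh).eventually] with s' H'
      refine iff_of_false ?_ hs
      rintro ⟨k, hk, H⟩
      have := FollowsAt.speed_unique hh hk H' H
      norm_num at this
  by_cases h0 : p 0
  · left
    intro h hh s hs
    refine (hφ.exists_followsAt hh hs).resolve_right fun H => ?_
    obtain ⟨k, hk, H'⟩ := forall_of_eventually_iff hloc h0 s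
    have := FollowsAt.speed_unique hh hk H H'
    norm_num at this
  · right
    intro h hh s hs
    exact hp s (forall_of_eventually_iff (p := fun s => ¬ p s)
      (fun s => (hloc s).mono fun _ h => not_congr h) h0 s) h hh hs

/-- The coordinates in `D` at which the curve agrees with the slice form an open and closed set, and
`D` is connected. So the curve runs through the slice all the way. -/
theorem Follows.eq_point [T2Space Ω] {φ : ℝ → Ω} (hφ : L.Follows 1 φ) {h : FlatChart Ω}
    (hh : h ∈ L.maximalAtlas) (hs : φ 0 ∈ h.source) {t : ℝ} (ht : h.tcoord (φ 0) + t ∈ h.D) :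
    φ t = h.point (h.tcoord (φ 0) + t) (h.ccoord (φ 0)) := by
  have : PreconnectedSpace h.D :=
    isPreconnected_iff_preconnectedSpace.1 h.isConnected_D.isPreconnected
  let p : h.D → Prop := fun d => φ (d - h.tcoord (φ 0)) = h.point d (h.ccoord (φ 0))
  have hd : Continuous fun d : h.D => (d : ℝ) - h.tcoord (φ 0) := by fun_prop
  have hc1 : Continuous fun d : h.D => φ (d - h.tcoord (φ 0)) := hφ.continuous.comp hd
  have hc2 : Continuous fun d : h.D => h.point d (h.ccoord (φ 0)) := by
    rw [continuous_iff_continuousAt]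
    intro d
    exact FlatChart.continuousAt_point d.2 continuous_subtype_val.continuousAt continuousAt_const
  have hloc : ∀ d, ∀ᶠ d' in 𝓝 d, (p d' ↔ p d) := by
    intro d
    by_cases hp : p d
    · have hmem : φ (d - h.tcoord (φ 0)) ∈ h.source := by
        rw [show φ (d - h.tcoord (φ 0)) = _ from hp]; exact FlatChart.point_mem d.2 _
      filter_upwards [hd.continuousAt.eventually (hφ h hh _ hmem)] with d' hd'
      refine iff_of_true ?_ hp
      refine h.ext_coord hd'.1 (FlatChart.point_mem d'.2 _) ?_ ?_
      · rw [hd'.2.2, show φ (d - h.tcoord (φ 0)) = _ from hp, FlatChart.tcoord_point d.2,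
          FlatChart.tcoord_point d'.2]
        ring
      · rw [hd'.2.1, show φ (d - h.tcoord (φ 0)) = _ from hp, FlatChart.ccoord_point d.2,
          FlatChart.ccoord_point d'.2]
    · filter_upwards [(isClosed_eq hc1 hc2).isOpen_compl.mem_nhds hp] with d' hd'
      exact iff_of_false hd' hp
  have h0 : p ⟨h.tcoord (φ 0), h.tcoord_mem hs⟩ := by
    simp only [p, sub_self]
    exact (FlatChart.point_coord hs).symm
  have h1 := forall_of_eventually_iff hloc h0 ⟨_, ht⟩
  simpa only [p, add_sub_cancel_left] using h1

theorem Follows.ext [T2Space Ω] {φ ψ : ℝ → Ω} (hφ : L.Follows 1 φ) (hψ : L.Follows 1 ψ)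
    (h0 : φ 0 = ψ 0) (s : ℝ) : φ s = ψ s := by
  refine forall_of_eventually_iff (p := fun s => φ s = ψ s) (fun s => ?_) h0 s
  by_cases hs : φ s = ψ s
  · obtain ⟨h, hh, hsh⟩ := L.exists_chart (φ s)
    filter_upwards [hφ h hh s hsh, hψ h hh s (hs ▸ hsh)] with s' h1 h2
    refine iff_of_true (h.ext_coord h1.1 h2.1 ?_ ?_) hs
    · rw [h1.2.2, h2.2.2, hs]
    · rw [h1.2.1, h2.2.1, hs]
  · filter_upwards [(isClosed_eq hφ.continuous hψ.continuous).isOpen_compl.mem_nhds hs] with s' hs'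
    exact iff_of_false hs' hs

end FlatLamination

/-! ### The translation flow and its transverse structure -/

namespace TilableLamination

variable {Ω : Type u}

section

variable [TopologicalSpace Ω] (L : TilableLamination Ω)

theorem mem_leaf_self (x : Ω) : x ∈ L.leaf x := mem_sInter.2 fun _ hS => hS.1

/-- Every leaf has a parametrization at unit speed in the positive direction. -/
theorem exists_follows (x : Ω) : ∃ φ : ℝ → Ω, L.Follows 1 φ ∧ Function.Injective φ ∧ φ 0 = x ∧
    range φ = L.leaf x := by
  obtain ⟨φ, hφ⟩ := L.leaf_isometric x
  obtain ⟨s₀, hs₀⟩ : x ∈ range φ := by rw [hφ.range_eq]; exact L.mem_leaf_self x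
  have key : ∀ a : ℝ, a ≠ 0 → Function.Surjective fun s : ℝ => a * s + s₀ := fun a ha s =>
    ⟨(s - s₀) / a, by simp only; field_simp; ring⟩
  have inj : ∀ a : ℝ, a ≠ 0 → Function.Injective fun s : ℝ => a * s + s₀ := fun a ha s s' h =>
    mul_left_cancel₀ ha (add_right_cancel h)
  rcases hφ.follows with H | H
  · refine ⟨fun s => φ (1 * s + s₀), by simpa using H.comp_affine 1 s₀,
      hφ.injective.comp (inj 1 one_ne_zero), by simpa using hs₀, ?_⟩
    rw [← hφ.range_eq]
    exact (key 1 one_ne_zero).range_comp φ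
  · refine ⟨fun s => φ (-1 * s + s₀), by simpa using H.comp_affine (-1) s₀,
      hφ.injective.comp (inj (-1) (by norm_num)), by simpa using hs₀, ?_⟩
    rw [← hφ.range_eq]
    exact (key (-1) (by norm_num)).range_comp φ

/-- The translation along the leaves. -/
noncomputable def translation (s : ℝ) (x : Ω) : Ω := (L.exists_follows x).choose s

theorem translation_follows (x : Ω) : L.Follows 1 fun s => L.translation s x :=
  (L.exists_follows x).choose_spec.1

theorem translation_injective (x : Ω) : Function.Injective fun s => L.translation s x :=
  (L.exists_follows x).choose_spec.2.1

theorem translation_zero (x : Ω) : L.translation 0 x = x :=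
  (L.exists_follows x).choose_spec.2.2.1

theorem range_translation (x : Ω) : (range fun s => L.translation s x) = L.leaf x :=
  (L.exists_follows x).choose_spec.2.2.2

/-- The filter of the neighbourhoods of a point in the verticals. -/
noncomputable def verticalNhds (x : Ω) : Filter Ω :=
  𝓝[(L.exists_chart x).choose.vertical x] x

theorem nhdsWithin_vertical {h : FlatChart Ω} (hh : h ∈ L.maximalAtlas) {x : Ω}
    (hx : x ∈ h.source) : 𝓝[h.vertical x] x = L.verticalNhds x :=
  FlatLamination.nhdsWithin_vertical_eq hh (L.exists_chart x).choose_spec.1 hx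
    (L.exists_chart x).choose_spec.2

theorem isOpen_chart_domain (h : FlatChart Ω) :
    IsOpen {p : ℝ × Ω | p.2 ∈ h.source ∧ h.tcoord p.2 + p.1 ∈ h.D} := by
  have hc : ContinuousOn (fun p : ℝ × Ω => h.tcoord p.2 + p.1) (univ ×ˢ h.source) :=
    (h.continuousOn_tcoord.comp continuousOn_snd fun p hp => hp.2).add continuousOn_fst
  have h1 := hc.isOpen_inter_preimage (isOpen_univ.prod h.isOpen_source) h.isOpen_D
  convert h1 using 1
  ext p
  simp

variable [T2Space Ω]

/-- The parametrizations chosen at different points of a leaf agree up to a shift, by uniqueness of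
unit-speed curves. -/
theorem translation_add (s s' : ℝ) (x : Ω) :
    L.translation (s + s') x = L.translation s (L.translation s' x) := by
  have h1 : L.Follows 1 fun r => L.translation (1 * r + s') x := by
    simpa only [mul_one] using (L.translation_follows x).comp_affine 1 s'
  have h2 := FlatLamination.Follows.ext h1 (L.translation_follows (L.translation s' x))
    (by simp [translation_zero]) s
  simpa using h2

theorem translation_eq_point {h : FlatChart Ω} (hh : h ∈ L.maximalAtlas) {x : Ω}
    (hx : x ∈ h.source) {s : ℝ} (hs : h.tcoord x + s ∈ h.D) :
    L.translation s x = h.point (h.tcoord x + s) (h.ccoord x) := by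
  have h0 := L.translation_zero x
  have h1 := (L.translation_follows x).eq_point hh (t := s) (by rwa [h0]) (by rwa [h0])
  rwa [h0] at h1

theorem continuousAt_translation_of_chart {h : FlatChart Ω} (hh : h ∈ L.maximalAtlas) {p : ℝ × Ω}
    (hp : p.2 ∈ h.source) (hp' : h.tcoord p.2 + p.1 ∈ h.D) :
    ContinuousAt (fun p : ℝ × Ω => L.translation p.1 p.2) p := by
  have h1 : (fun p : ℝ × Ω => L.translation p.1 p.2) =ᶠ[𝓝 p]
      fun p => h.point (h.tcoord p.2 + p.1) (h.ccoord p.2) := by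
    filter_upwards [(isOpen_chart_domain h).mem_nhds ⟨hp, hp'⟩] with q hq
    exact L.translation_eq_point hh hq.1 hq.2
  refine ContinuousAt.congr ?_ h1.symm
  have ht : ContinuousAt (fun p : ℝ × Ω => h.tcoord p.2) p :=
    ContinuousAt.comp (f := Prod.snd) (h.continuousOn_tcoord.continuousAt
      (h.isOpen_source.mem_nhds hp)) continuousAt_snd
  have hc : ContinuousAt (fun p : ℝ × Ω => h.ccoord p.2) p :=
    ContinuousAt.comp (f := Prod.snd) (h.continuousOn_ccoord.continuousAt
      (h.isOpen_source.mem_nhds hp)) continuousAt_snd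
  exact FlatChart.continuousAt_point hp' (ht.add continuousAt_fst) hc

/-- Charts and compactness give continuity for `|s| < ε`, with `ε` uniform over `Ω`. The group law
then carries continuity from time `s` to all times within `ε` of it. -/
theorem continuous_translation [CompactSpace Ω] :
    Continuous fun p : ℝ × Ω => L.translation p.1 p.2 := by
  set F : ℝ × Ω → Ω := fun p => L.translation p.1 p.2
  have h1 : ∀ᶠ s in 𝓝 (0 : ℝ), ∀ x ∈ (univ : Set Ω), ContinuousAt F (s, x) := by
    refine isCompact_univ.eventually_forall_of_forall_eventually fun x _ => ?_
    obtain ⟨h, hh, hx⟩ := L.exists_chart x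
    filter_upwards [(isOpen_chart_domain h).mem_nhds
      (show (0, x) ∈ _ from ⟨hx, by simpa using h.tcoord_mem hx⟩)] with q hq
    exact L.continuousAt_translation_of_chart hh hq.1 hq.2
  obtain ⟨ε, hε, hball⟩ := Metric.eventually_nhds_iff_ball.1 h1
  have hstep : ∀ s δ : ℝ, δ ∈ Metric.ball (0 : ℝ) ε → (∀ x, ContinuousAt F (s, x)) →
      ∀ x, ContinuousAt F (s + δ, x) := by
    intro s δ hδ hs x
    have e : F = fun p => F (δ, F (p.1 - δ, p.2)) := by
      funext p
      simp only [F]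
      rw [← L.translation_add, add_sub_cancel]
    rw [e]
    have a1 : ContinuousAt (fun p : ℝ × Ω => F (p.1 - δ, p.2)) (s + δ, x) := by
      have a2 : Continuous fun p : ℝ × Ω => (p.1 - δ, p.2) := by fun_prop
      have a3 : ContinuousAt F (s + δ - δ, x) := by rw [add_sub_cancel_right]; exact hs x
      exact ContinuousAt.comp (g := F) (f := fun p : ℝ × Ω => (p.1 - δ, p.2)) a3 a2.continuousAt
    refine ContinuousAt.comp (g := F) (f := fun p : ℝ × Ω => (δ, F (p.1 - δ, p.2)))
      (hball δ hδ _ trivial) (continuousAt_const.prodMk a1)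
  have hloc : ∀ s : ℝ, ∀ᶠ s' in 𝓝 s, ((∀ x, ContinuousAt F (s', x)) ↔
      ∀ x, ContinuousAt F (s, x)) := by
    intro s
    filter_upwards [Metric.ball_mem_nhds s hε] with s' hs'
    rw [Metric.mem_ball, Real.dist_eq] at hs'
    constructor
    · intro H
      have := hstep s' (s - s') (by
        rw [Metric.mem_ball, dist_zero_right, Real.norm_eq_abs, abs_sub_comm]; exact hs') H
      simpa using this
    · intro H
      have := hstep s (s' - s) (by
        rw [Metric.mem_ball, dist_zero_right, Real.norm_eq_abs]; exact hs') H
      simpa using this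
  rw [continuous_iff_continuousAt]
  rintro ⟨s, x⟩
  have h0 : ∀ x, ContinuousAt F (0, x) := fun x => hball 0 (Metric.mem_ball_self hε) x trivial
  exact forall_of_eventually_iff (p := fun s => ∀ x, ContinuousAt F (s, x)) hloc h0 s x

/-- The flow along the leaves. -/
noncomputable def flow [CompactSpace Ω] : Flow ℝ Ω where
  toFun := L.translation
  cont' := L.continuous_translation
  map_add' := L.translation_add
  map_zero' := L.translation_zero

end

section

variable [MetricSpace Ω] [CompactSpace Ω] (L : TilableLamination Ω)

theorem flow_eq_point {h : FlatChart Ω} (hh : h ∈ L.maximalAtlas) {x : Ω}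
    (hx : x ∈ h.source) {s : ℝ} (hs : h.tcoord x + s ∈ h.D) :
    L.flow s x = h.point (h.tcoord x + s) (h.ccoord x) :=
  L.translation_eq_point hh hx hs

theorem range_flow (x : Ω) : (range fun s => L.flow s x) = L.leaf x := L.range_translation x

theorem tendsto_flow_of_chart {h : FlatChart Ω} (hh : h ∈ L.maximalAtlas) {x : Ω}
    (hx : x ∈ h.source) {s : ℝ} (hs : h.tcoord x + s ∈ h.D) :
    Tendsto (L.flow s) (L.verticalNhds x) (L.verticalNhds (L.flow s x)) := by
  have hx' : L.flow s x ∈ h.source := by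
    rw [L.flow_eq_point hh hx hs]; exact FlatChart.point_mem hs _
  rw [← L.nhdsWithin_vertical hh hx, ← L.nhdsWithin_vertical hh hx']
  refine tendsto_nhdsWithin_iff.2
    ⟨(L.flow.continuous_toFun s).continuousAt.tendsto.mono_left nhdsWithin_le_nhds, ?_⟩
  filter_upwards [self_mem_nhdsWithin] with y hy
  have hs' : h.tcoord y + s ∈ h.D := by rwa [hy.2]
  rw [L.flow_eq_point hh hy.1 hs', L.flow_eq_point hh hx hs]
  refine ⟨FlatChart.point_mem hs' _, ?_⟩
  rw [FlatChart.tcoord_point hs', FlatChart.tcoord_point hs, hy.2]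

/-- Inside a box the flow shifts verticals to verticals; long times are reached by local constancy
of the statement in `s`. -/
theorem tendsto_flow (s : ℝ) (x : Ω) :
    Tendsto (L.flow s) (L.verticalNhds x) (L.verticalNhds (L.flow s x)) := by
  refine forall_of_eventually_iff (p := fun s =>
    Tendsto (L.flow s) (L.verticalNhds x) (L.verticalNhds (L.flow s x))) (fun s => ?_)
    (x₀ := 0) (by simpa using tendsto_id) s
  obtain ⟨h, hh, hz⟩ := L.exists_chart (L.flow s x)
  have hstep : ∀ r r' : ℝ, L.flow r x ∈ h.source → h.tcoord (L.flow r x) + (r' - r) ∈ h.D →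
      Tendsto (L.flow r) (L.verticalNhds x) (L.verticalNhds (L.flow r x)) →
      Tendsto (L.flow r') (L.verticalNhds x) (L.verticalNhds (L.flow r' x)) := by
    intro r r' h1 h2 h3
    have h4 := (L.tendsto_flow_of_chart hh h1 h2).comp h3
    rw [← L.flow.map_add, sub_add_cancel] at h4
    refine h4.congr fun y => ?_
    simp [← L.flow.map_add]
  have hD : ∀ᶠ s' in 𝓝 s, h.tcoord (L.flow s x) + (s' - s) ∈ h.D := by
    have : Continuous fun s' => h.tcoord (L.flow s x) + (s' - s) := by fun_prop
    exact this.continuousAt.eventually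
      (h.isOpen_D.mem_nhds (by simpa using h.tcoord_mem hz))
  filter_upwards [hD] with s' hs'
  have e : L.flow s' x = h.point (h.tcoord (L.flow s x) + (s' - s)) (h.ccoord (L.flow s x)) := by
    rw [← L.flow_eq_point hh hz hs', ← L.flow.map_add, sub_add_cancel]
  refine ⟨fun H => hstep s' s ?_ ?_ H, fun H => hstep s s' hz hs' H⟩
  · rw [e]; exact FlatChart.point_mem hs' _
  · rw [e, FlatChart.tcoord_point hs']
    rw [add_assoc, sub_add_sub_cancel, sub_self, add_zero]
    exact h.tcoord_mem hz

/-- A point `y` near `x` is obtained by flowing its projection along the slice to the vertical of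
`x` for the time `h.tcoord y - h.tcoord x`. -/
theorem nhds_le_flow (x : Ω) :
    𝓝 x ≤ map (fun p : ℝ × Ω => L.flow p.1 p.2) (𝓝 0 ×ˢ L.verticalNhds x) := by
  obtain ⟨h, hh, hx⟩ := L.exists_chart x
  rw [← L.nhdsWithin_vertical hh hx]
  have hxD := h.tcoord_mem hx
  have hct := h.continuousOn_tcoord.continuousAt (h.isOpen_source.mem_nhds hx)
  have hcc := h.continuousOn_ccoord.continuousAt (h.isOpen_source.mem_nhds hx)
  have h1 : Tendsto (fun y => h.tcoord y - h.tcoord x) (𝓝 x) (𝓝 0) := by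
    have := hct.sub (continuousAt_const (y := h.tcoord x))
    rwa [ContinuousAt, Pi.sub_apply, sub_self] at this
  have h2 : Tendsto (fun y => h.point (h.tcoord x) (h.ccoord y)) (𝓝 x) (𝓝[h.vertical x] x) := by
    refine tendsto_nhdsWithin_iff.2 ⟨?_, Eventually.of_forall fun y =>
      ⟨FlatChart.point_mem hxD _, FlatChart.tcoord_point hxD _⟩⟩
    have h3 : ContinuousAt (fun y => h.point (h.tcoord x) (h.ccoord y)) x :=
      FlatChart.continuousAt_point hxD continuousAt_const hcc
    simpa only [ContinuousAt, FlatChart.point_coord hx] using h3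
  have h3 := tendsto_map (f := fun p : ℝ × Ω => L.flow p.1 p.2)
    (x := 𝓝 (0 : ℝ) ×ˢ 𝓝[h.vertical x] x) |>.comp (h1.prodMk h2)
  have h4 : ((fun p : ℝ × Ω => L.flow p.1 p.2) ∘ fun y =>
      (h.tcoord y - h.tcoord x, h.point (h.tcoord x) (h.ccoord y))) =ᶠ[𝓝 x] id := by
    filter_upwards [h.isOpen_source.mem_nhds hx] with y hy
    have hm : h.point (h.tcoord x) (h.ccoord y) ∈ h.source := FlatChart.point_mem hxD _
    have ht : h.tcoord (h.point (h.tcoord x) (h.ccoord y)) = h.tcoord x :=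
      FlatChart.tcoord_point hxD _
    simp only [Function.comp_apply, id]
    rw [L.flow_eq_point hh hm (by rw [ht, add_sub_cancel]; exact h.tcoord_mem hy), ht,
      FlatChart.ccoord_point hxD, add_sub_cancel, FlatChart.point_coord hy]
  have h5 := h3.congr' h4
  exact h5

theorem exists_section (x : Ω) {U : Set Ω} (hU : U ∈ 𝓝 x) : ∃ C ⊆ U, IsCompact C ∧ x ∈ C ∧
    (∀ y ∈ C, 𝓝[C] y = L.verticalNhds y) ∧
      ∃ η > 0, ∀ y ∈ C, ∀ s, |s| < η → L.flow s y ∈ C → s = 0 := by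
  obtain ⟨h, hh, hx⟩ := L.exists_chart x
  have hdom : ∀ᶠ p : ℝ × Ω in 𝓝 (0, x), p.2 ∈ h.source ∧ h.tcoord p.2 + p.1 ∈ h.D :=
    (isOpen_chart_domain h).mem_nhds ⟨hx, by simpa using h.tcoord_mem hx⟩
  rw [nhds_prod_eq, eventually_prod_iff] at hdom
  obtain ⟨pa, hpa, pb, hpb, hdom⟩ := hdom
  obtain ⟨η, hη, hηp⟩ := Metric.eventually_nhds_iff_ball.1 hpa
  obtain ⟨N, hN, hNcl, hNU⟩ := exists_mem_nhds_isClosed_subset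
    (inter_mem hU (inter_mem (h.isOpen_source.mem_nhds hx) hpb))
  have hxv := FlatChart.mem_vertical_self hx
  obtain ⟨K, hK, hxK, hKN⟩ := L.exists_clopen_in_vertical hh x ⟨x, hxv⟩ (Subtype.val ⁻¹' N)
    (continuous_subtype_val.continuousAt.preimage_mem_nhds hN)
  obtain ⟨O, hO, hOK⟩ := isOpen_induced_iff.1 hK.isOpen
  obtain ⟨F, hF, hFK⟩ := isClosed_induced_iff.1 hK.isClosed
  set C : Set Ω := Subtype.val '' K with hCdef
  have hCN : C ⊆ N := by rintro _ ⟨y, hy, rfl⟩; exact hKN hy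
  have hCv : C ⊆ h.vertical x := by rintro _ ⟨y, hy, rfl⟩; exact y.2
  -- Clopenness of `K` is used twice: openness in the vertical gives the neighbourhood filters,
  -- closedness inside the closed set `N` gives compactness in `Ω`.
  have hCO : C = h.vertical x ∩ O := by
    rw [hCdef, ← hOK, Subtype.image_preimage_coe]
  have hCF : C = N ∩ h.tcoord ⁻¹' {h.tcoord x} ∩ F := by
    ext y
    constructor
    · rintro hy
      refine ⟨⟨hCN hy, (hCv hy).2⟩, ?_⟩
      obtain ⟨y, hy, rfl⟩ := hy
      rw [← hFK] at hy
      exact hy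
    · rintro ⟨⟨hyN, hyt⟩, hyF⟩
      refine ⟨⟨y, (hNU hyN).2.1, hyt⟩, ?_, rfl⟩
      rw [← hFK]
      exact hyF
  have hCc : IsCompact C := by
    rw [hCF]
    have : IsClosed (N ∩ h.tcoord ⁻¹' {h.tcoord x}) :=
      (h.continuousOn_tcoord.mono fun y hy => (hNU hy).2.1).preimage_isClosed_of_isClosed hNcl
        isClosed_singleton
    exact (this.inter hF).isCompact
  refine ⟨C, fun y hy => (hNU (hCN hy)).1, hCc, ⟨_, hxK, rfl⟩, fun y hy => ?_, η, hη,
    fun y hy s hs hsy => ?_⟩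
  · have h1 : h.vertical y = h.vertical x := by
      ext z
      simp only [FlatChart.vertical, (hCv hy).2]
    rw [← L.nhdsWithin_vertical hh (hCv hy).1, h1, hCO]
    rw [hCO] at hy
    exact nhdsWithin_inter_of_mem' (mem_nhdsWithin_of_mem_nhds (hO.mem_nhds hy.2))
  -- For `|s| < η` the orbit stays in the box, and the points of `C` share one leafwise coordinate.
  · have h1 := hdom (hηp s (by simpa using hs)) (hNU (hCN hy)).2.2
    have h2 := (hCv hsy).2
    rw [L.flow_eq_point hh h1.1 h1.2, FlatChart.tcoord_point h1.2, ← (hCv hy).2] at h2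
    linarith

theorem isTransverseTo_flow (hL : L.IsMinimal) : IsTransverseTo L.flow L.verticalNhds where
  free s x h := L.translation_injective x (h.trans (L.translation_zero x).symm)
  dense x := by rw [L.range_flow]; exact hL x
  tendsto := L.tendsto_flow
  nhds_le := L.nhds_le_flow
  exists_section x _ hU := L.exists_section x hU
  exists_coord x := by
    obtain ⟨h, hh, hx⟩ := L.exists_chart x
    refine ⟨h.source, h.isOpen_source, hx, h.tcoord, h.continuousOn_tcoord,
      fun S hS hSc y hy z hz => ?_⟩
    have := L.totallyDisconnected h hh
    have hc : h.ccoord y = h.ccoord z :=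
      (hSc.image _ (h.continuousOn_ccoord.mono hS)).subsingleton
        (mem_image_of_mem _ hy) (mem_image_of_mem _ hz)
    rw [L.flow_eq_point hh (hS hy) (by rw [add_sub_cancel]; exact h.tcoord_mem (hS hz)),
      add_sub_cancel, hc, FlatChart.point_coord (hS hz)]

theorem preservesVertical_iff_tendsto (f : Ω ≃ₜ Ω) :
    L.PreservesVertical f ↔ ∀ x, Tendsto f (L.verticalNhds x) (L.verticalNhds (f x)) := by
  rw [preservesVertical_iff]
  constructor
  · intro H x
    obtain ⟨h, hh, hx⟩ := L.exists_chart x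
    obtain ⟨k, hk, hx'⟩ := L.exists_chart (f x)
    rw [← L.nhdsWithin_vertical hh hx, ← L.nhdsWithin_vertical hk hx']
    exact tendsto_nhdsWithin_iff.2
      ⟨f.continuous.continuousAt.tendsto.mono_left nhdsWithin_le_nhds, H h hh k hk x hx hx'⟩
  · intro H h hh k hk x hx hx'
    have h1 := H x
    rw [← L.nhdsWithin_vertical hh hx, ← L.nhdsWithin_vertical hk hx'] at h1
    exact (tendsto_nhdsWithin_iff.1 h1).2

/-- Sending each point into its own orbit suffices for surjectivity on leaves: apply it at the
preimage and flow back. -/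
theorem mem_homeoL_iff (f : Ω ≃ₜ Ω) : f ∈ L.homeoL ↔ ∀ x, ∃ s, f x = L.flow s x := by
  constructor
  · intro hf x
    have h1 : f x ∈ L.leaf x := by
      rw [← (show f '' L.leaf x = L.leaf x from hf x)]
      exact mem_image_of_mem _ (L.mem_leaf_self x)
    rw [← L.range_flow] at h1
    obtain ⟨s, hs⟩ := h1
    exact ⟨s, hs.symm⟩
  · intro hf x
    rw [← L.range_flow]
    ext y
    constructor
    · rintro ⟨_, ⟨s, rfl⟩, rfl⟩
      obtain ⟨r, hr⟩ := hf (L.flow s x)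
      exact ⟨r + s, by simp only [hr, L.flow.map_add]⟩
    · rintro ⟨s, rfl⟩
      obtain ⟨r, hr⟩ := hf (f.symm (L.flow s x))
      rw [f.apply_symm_apply] at hr
      refine ⟨f.symm (L.flow s x), ⟨-r + s, ?_⟩, f.apply_symm_apply _⟩
      simp only [L.flow.map_add]
      conv_lhs => rw [hr]
      exact L.flow.neg_apply_self _ _

end

end TilableLamination

/-! ### Uniform perfectness of the homeomorphism groups -/

namespace TilableLamination

variable {Ω : Type u} [MetricSpace Ω] [CompactSpace Ω] {L : TilableLamination Ω}

theorem joined_one_homeoL (hL : L.IsMinimal) (f : L.homeoL) : Joined 1 f := by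
  choose α hα using (L.mem_homeoL_iff f).1 f.2
  obtain ⟨γ, hγ, h0, h1, hγα⟩ := (L.isTransverseTo_flow hL).exists_isotopy hα
  have hmem : ∀ t, γ t ∈ L.homeoL := fun t => (L.mem_homeoL_iff _).2 fun x => ⟨_, hγα t x⟩
  exact ⟨⟨⟨fun t => ⟨γ t, hmem t⟩, hγ.subtype_mk _⟩, Subtype.ext h0, Subtype.ext h1⟩⟩

theorem homeoLZero_eq_top (hL : L.IsMinimal) : L.homeoLZero = ⊤ :=
  eq_top_iff.2 fun f _ => pathComponent_subset_component _ (joined_one_homeoL hL f)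

theorem continuous_eval_homeomorph (x : Ω) : Continuous fun f : Ω ≃ₜ Ω => f x :=
  (continuous_eval_const (F := C(Ω, Ω)) x).comp
    (continuous_fst.comp isInducing_homeoPair.continuous)

/-- A homeomorphism joined to the identity maps every point to a point of its orbit. -/
theorem exists_time_of_path (hL : L.IsMinimal) {f : Ω ≃ₜ Ω} (γ : Path 1 f) (x : Ω) :
    ∃ s, f x = L.flow s x := by
  have hT := L.isTransverseTo_flow hL
  have hc : Continuous fun t : ℝ => γ.extend t x :=
    (continuous_eval_homeomorph x).comp γ.continuous_extend
  have hloc : ∀ t : ℝ, ∀ᶠ t' in 𝓝 t,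
      ((∃ s, γ.extend t' x = L.flow s x) ↔ ∃ s, γ.extend t x = L.flow s x) := by
    intro t
    obtain ⟨N, hN, hxN, τ, -, H⟩ := hT.exists_coord (γ.extend t x)
    obtain ⟨ε, hε, hball⟩ := Metric.mem_nhds_iff.1
      (hc.continuousAt.preimage_mem_nhds (hN.mem_nhds hxN))
    filter_upwards [Metric.ball_mem_nhds t hε] with t' ht'
    -- For times near `t` the trajectory of `x` is a connected subset of one box, hence lies in one
    -- slice.
    have h1 := H ((fun t : ℝ => γ.extend t x) '' Metric.ball t ε) (image_subset_iff.2 hball)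
      ((convex_ball _ _).isPreconnected.image _ hc.continuousOn)
    have hm := mem_image_of_mem (fun t : ℝ => γ.extend t x) ht'
    have hm' := mem_image_of_mem (fun t : ℝ => γ.extend t x) (Metric.mem_ball_self (x := t) hε)
    constructor
    · rintro ⟨s, hs⟩
      exact ⟨_ + s, (h1 _ hm _ hm').trans (by rw [L.flow.map_add, ← hs])⟩
    · rintro ⟨s, hs⟩
      exact ⟨_ + s, (h1 _ hm' _ hm).trans (by rw [L.flow.map_add, ← hs])⟩
  have h1 := forall_of_eventually_iff hloc (x₀ := 0) ⟨0, by simp⟩ 1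
  simpa using h1

/-- A path from the identity cannot leave the leaves. Conversely the displacement is locally
constant on verticals, and so are its multiples by `t`, so the isotopy along the leaves stays in
`homeoVsp`. -/
theorem mem_dVsp_iff (hL : L.IsMinimal) (f : L.homeoVsp) :
    f ∈ L.dVsp ↔ ∀ x, ∃ s, (f : Ω ≃ₜ Ω) x = L.flow s x := by
  have hT := L.isTransverseTo_flow hL
  constructor
  · rintro ⟨γ⟩ x
    exact exists_time_of_path hL (γ.map (f := Subtype.val) continuous_subtype_val) x
  · intro hf
    choose α hα using hf
    have hc := hT.continuous_displacement (f : Ω ≃ₜ Ω).continuous hα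
    obtain ⟨γ, hγ, h0, h1, hγα⟩ := hT.exists_isotopy hα
    have hV := (L.preservesVertical_iff_tendsto f).1 f.2
    have hmem : ∀ t, γ t ∈ L.homeoVsp := fun t =>
      (L.preservesVertical_iff_tendsto _).2 fun x => hT.tendsto_of_displacement (hγα t)
        ((hT.displacement_of_tendsto hc hα (hV x)).mono fun y hy => by rw [hy])
    exact ⟨⟨⟨fun t => ⟨γ t, hmem t⟩, hγ.subtype_mk _⟩, Subtype.ext h0, Subtype.ext h1⟩⟩

end TilableLamination

theorem isUniformlyPerfect_of_two_commutators {G : Type*} [Group G]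
    (h : ∀ f : G, ∃ a b c d : G, f = ⁅a, b⁆ * ⁅c, d⁆) : IsUniformlyPerfect G := by
  refine ⟨2, fun f => ?_⟩
  obtain ⟨a, b, c, d, e⟩ := h f
  refine ⟨[⁅a, b⁆, ⁅c, d⁆], le_rfl, ?_, by simp [e]⟩
  intro g hg
  simp only [List.mem_cons, List.not_mem_nil, or_false] at hg
  rcases hg with rfl | rfl
  · exact commutator_mem_commutatorSet a b
  · exact commutator_mem_commutatorSet c d

theorem mainTheorem2 {Ω : Type u} [MetricSpace Ω] [CompactSpace Ω] (L : TilableLamination Ω)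
    (hL : L.IsMinimal) :
    (∀ f : L.homeoLZero, ∃ a b c d : L.homeoLZero, f = ⁅a, b⁆ * ⁅c, d⁆) ∧
    (∀ f : L.dVsp, ∃ a b c d : L.dVsp, f = ⁅a, b⁆ * ⁅c, d⁆) ∧
    IsUniformlyPerfect L.homeoLZero ∧
    IsUniformlyPerfect L.dVsp := by
  have hT := L.isTransverseTo_flow hL
  have : Nonempty Ω := by
    obtain ⟨Ξ, -, ⟨e⟩⟩ := L.exists_cantor_transversal
    exact ⟨e.symm fun _ => true⟩
  have h1 : ∀ f : L.homeoLZero, ∃ a b c d : L.homeoLZero, f = ⁅a, b⁆ * ⁅c, d⁆ := by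
    intro f
    obtain ⟨a, b, c, d, e, hm, -⟩ :=
      hT.exists_two_commutators ((L.mem_homeoL_iff f.1.1).1 f.1.2)
    have hmem : ∀ h ∈ ({a, b, c, d} : Set (Ω ≃ₜ Ω)), h ∈ L.homeoL := fun h hh =>
      (L.mem_homeoL_iff h).2 (hm h hh)
    have htop : ∀ h : L.homeoL, h ∈ L.homeoLZero := fun h => by
      rw [TilableLamination.homeoLZero_eq_top hL]; trivial
    refine ⟨⟨⟨a, hmem a (by simp)⟩, htop _⟩, ⟨⟨b, hmem b (by simp)⟩, htop _⟩,
      ⟨⟨c, hmem c (by simp)⟩, htop _⟩, ⟨⟨d, hmem d (by simp)⟩, htop _⟩,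
      Subtype.ext (Subtype.ext e)⟩
  have h2 : ∀ f : L.dVsp, ∃ a b c d : L.dVsp, f = ⁅a, b⁆ * ⁅c, d⁆ := by
    intro f
    obtain ⟨a, b, c, d, e, hm, hV⟩ :=
      hT.exists_two_commutators ((TilableLamination.mem_dVsp_iff hL f.1).1 f.2)
    have hV' := hV ((L.preservesVertical_iff_tendsto _).1 f.1.2)
    have hmem : ∀ h ∈ ({a, b, c, d} : Set (Ω ≃ₜ Ω)), h ∈ L.homeoVsp := fun h hh =>
      (L.preservesVertical_iff_tendsto h).2 (hV' h hh)
    refine ⟨⟨⟨a, hmem a (by simp)⟩, ?_⟩, ⟨⟨b, hmem b (by simp)⟩, ?_⟩,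
      ⟨⟨c, hmem c (by simp)⟩, ?_⟩, ⟨⟨d, hmem d (by simp)⟩, ?_⟩,
      Subtype.ext (Subtype.ext e)⟩ <;>
    exact (TilableLamination.mem_dVsp_iff hL _).2 (hm _ (by simp))
  exact ⟨h1, h2, isUniformlyPerfect_of_two_commutators h1, isUniformlyPerfect_of_two_commutators h2⟩
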